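/- **Setting.** Let $\mathbb H^3=\{z=x+yj : x\in\mathbb C,\ y>0\}$ (a subset of the quaternions), with $\mathrm{SL}_2(\mathbb C)$ acting by $\begin{pmatrix}a&b\\c&d\end{pmatrix}z=(az+b)(cz+d)^{-1}$ and with the hyperbolic metric $ds^2=(dx_1^2+dx_2^2+dy^2)/y^2$, $x=x_1+ix_2$. Let $\overline{\mathbb H^3}=\mathbb H^3\cup\mathbb C\cup\{\infty\}$, the one-point compactification of $\{(x,y):x\in\mathbb C,\ y\ge 0\}$. A subset of $\overline{\mathbb H^3}$ is convex if with any two of its points it contains the closed geodesic segment joining them (endpoints at infinity allowed), and $\mathcal C_{\mathbb H}(S)$ denotes the smallest convex set containing $S$. For $n>3$, $\mathcal C_{\mathbb H}(p_1,\dots,p_n)$ is called the solid convex polytope with vertices $p_1,\dots,p_n$ if the points do not all lie on the closure of one totally geodesic surface (vertical half-plane or hemisphere centred on $\mathbb C$) and no $p_i$ lies in the convex hull of the others. Let $\mathrm{conj}(g)$ be the matrix of $X\mapsto gXg^{-1}$ on $\mathfrak{sl}_2(\mathbb C)$ in the basis $\begin{pmatrix}0&1\\1&0\end{pmatrix},\begin{pmatrix}0&i\\-i&0\end{pmatrix},\begin{pmatrix}1&0\\0&-1\end{pmatrix}$,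 which is orthonormal for $\frac12\mathrm{Tr}(XY)$, and let $\Gamma=\mathrm{conj}^{-1}(\mathrm{SO}(3,\mathbb Z[i]))\subset\mathrm{SL}_2(\mathbb C)$. Let $N\le H$ be groups, with $H$ acting on a space $X$ and $N$ acting trivially. A set $F\subseteq X$ is a fundamental domain for $N\backslash H$ if $X=HF$ and $\gamma_1F\cap\gamma_2F\subseteq\gamma_1\partial F\cap\gamma_2\partial F$ whenever $N\gamma_1\ne N\gamma_2$. Put $\phi=(\phi_1,\phi_2,\phi_3)=(-\log y,x_1,x_2):\mathbb H^3\to\mathbb R^3$ and $\phi_{[2,3]}(z)=\phi_2(z)+i\phi_3(z)=x\in\mathbb C$. For a group $\Gamma$ acting on $\mathbb H^3$, let $\Gamma^{\phi_{[1,j]}}$ be the subgroup of those $\gamma$ with $\phi_i\circ\gamma=\phi_i$ for all $i\le j$; write $\Gamma^{\phi_1}=\Gamma^{\phi_{[1,1]}}$. Thus $\Gamma^{\phi_{[1,3]}}$ is the kernel of the action. Let $\Delta_{1,\gamma}=\phi_1\circ\phi^{-1}-\phi_1\circ\gamma\circ\phi^{-1}:\mathbb R^3\to\mathbb R$. Consider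 the axioms: * **A1.** For $j\in\{2,3\}$ and $\gamma\in\Gamma^{\phi_{[1,j-1]}}$, $\phi_j\circ\gamma$ does not depend on the first $j-1$ coordinates. * **A2.** For $\gamma\in\Gamma\setminus\Gamma^{\phi_1}$, $\Delta_{1,\gamma}$ has no zero that is a critical point. * **A3.** For all $z\in\mathbb H^3$ and $B\in\mathbb R$ there is a neighbourhood $U$ of $z$ such that $\phi_1(\Gamma^{\phi_1}\gamma U)\cap(-\infty,B]\ne\emptyset$ for only finitely many cosets $\Gamma^{\phi_1}\gamma$, $\gamma\in\Gamma$. * **A4.** For each $z\in\mathbb H^3$ there is a unit vector $u\in\mathbb R^3$ with $D_u\Delta_{1,\gamma}(\phi(z))<0$ for all $\gamma\in\Gamma\setminus\Gamma^{\phi_1}$. Under A1, $\Gamma^{\phi_1}$ acts on $\mathbb C$ by $t\mapsto\phi_{[2,3]}(\gamma(t+j))$. A set $\mathcal F\subseteq\mathbb H^3$ is the *good Grenier fundamental domain* for $\Gamma$ associated to $\mathcal G\subseteq\mathbb C$ if: the action satisfies A1–A4; $\mathcal G$ is a fundamental domain for the induced action of $\Gamma^{\phi_{[1,3]}}\backslash\Gamma^{\phi_1}$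 on $\mathbb C$ with $\mathcal G=\overline{\mathrm{int}\,\mathcal G}$; $\mathcal F=\phi_{[2,3]}^{-1}(\mathcal G)\cap\{z:\phi_1(z)\le\phi_1(\gamma z)\ \forall\gamma\in\Gamma\}$; and $\mathcal F$ is a fundamental domain for the action of $\Gamma^{\phi_{[1,3]}}\backslash\Gamma$ on $\mathbb H^3$. **Proposition.** Let $P=\mathcal C_{\mathbb H}(1+\sqrt2\,j,\ 2+j,\ 1+i+j,\ \infty)\subset\overline{\mathbb H^3}$. Then $P$ is a solid convex polytope with these four points as vertices; $P\cap\mathbb H^3$ is the good Grenier fundamental domain for the action of $\Gamma=\mathrm{conj}^{-1}(\mathrm{SO}(3,\mathbb Z[i]))$ on $\mathbb H^3$ associated to the Euclidean triangle $\mathcal G$ with vertices $1,\,2,\,1+i$; and $P=(P\cap\mathbb H^3)\cup\{\infty\}$. -/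

import Mathlib

namespace Grenier

open Matrix Set Topology
open scoped Quaternion

noncomputable section

/-! ## Hyperbolic 3-space and fractional linear transformations -/

/-- The upper half-space `H^3 = { x + y j : x ∈ ℂ, y > 0 }`. -/
@[ext]
structure H3 where
  x : ℂ
  y : ℝ
  y_pos : 0 < y

/-- The topology of `H^3` is the one given by the coordinates `(x, y)`. -/
instance : TopologicalSpace H3 :=
  TopologicalSpace.induced (fun z : H3 => (z.x, z.y)) inferInstance

/-- The point `x + y j` as a Hamilton quaternion. -/
def H3.toQuat (z : H3) : ℍ[ℝ] := ⟨z.x.re, z.x.im, z.y, 0⟩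

/-- A complex number as a Hamilton quaternion. -/
def cq (w : ℂ) : ℍ[ℝ] := ⟨w.re, w.im, 0, 0⟩

/-- The squared norm of the quaternion `c z + d`. -/
def denomSq (c d : ℂ) (z : H3) : ℝ :=
  Complex.normSq (c * z.x + d) + Complex.normSq c * z.y ^ 2

theorem denomSq_pos {c d : ℂ} (h : c ≠ 0 ∨ d ≠ 0) (z : H3) : 0 < denomSq c d z := by
  unfold denomSq
  by_cases hc : c = 0
  · have hd : d ≠ 0 := by
      rcases h with h | h
      · exact absurd hc h
      · exact h
    have := Complex.normSq_pos.2 hd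
    simpa [hc] using this
  · have h1 := Complex.normSq_pos.2 hc
    have h2 := Complex.normSq_nonneg (c * z.x + d)
    have h3 := z.y_pos
    positivity

abbrev SL2C : Type := Matrix.SpecialLinearGroup (Fin 2) ℂ

theorem bottom_row_ne_zero (g : SL2C) : g.1 1 0 ≠ 0 ∨ g.1 1 1 ≠ 0 := by
  by_contra h
  push Not at h
  have := g.2
  rw [Matrix.det_fin_two, h.1, h.2] at this
  simp at this

/-- The fractional linear transformation `z ↦ (a z + b) (c z + d)⁻¹` of `H^3`, in coordinates;
see `toQuat_smul` for the quaternionic form. -/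
instance : SMul SL2C H3 where
  smul g z :=
    { x := ((g.1 0 0 * z.x + g.1 0 1) * star (g.1 1 0 * z.x + g.1 1 1)
            + g.1 0 0 * star (g.1 1 0) * (z.y : ℂ) ^ 2) / (denomSq (g.1 1 0) (g.1 1 1) z : ℂ)
      y := z.y / denomSq (g.1 1 0) (g.1 1 1) z
      y_pos := div_pos z.y_pos (denomSq_pos (bottom_row_ne_zero g) z) }

theorem smul_x (g : SL2C) (z : H3) :
    (g • z).x = ((g.1 0 0 * z.x + g.1 0 1) * star (g.1 1 0 * z.x + g.1 1 1)
            + g.1 0 0 * star (g.1 1 0) * (z.y : ℂ) ^ 2) / (denomSq (g.1 1 0) (g.1 1 1) z : ℂ) :=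
  rfl

theorem smul_y (g : SL2C) (z : H3) : (g • z).y = z.y / denomSq (g.1 1 0) (g.1 1 1) z := rfl

theorem toQuat_injective : Function.Injective H3.toQuat := by
  intro z w h
  have h1 := congrArg (fun q : ℍ[ℝ] => q.re) h
  have h2 := congrArg (fun q : ℍ[ℝ] => q.imI) h
  have h3 := congrArg (fun q : ℍ[ℝ] => q.imJ) h
  exact H3.ext (Complex.ext h1 h2) h3

@[simp] theorem cq_re (w : ℂ) : (cq w).re = w.re := rfl
@[simp] theorem cq_imI (w : ℂ) : (cq w).imI = w.im := rfl
@[simp] theorem cq_imJ (w : ℂ) : (cq w).imJ = 0 := rfl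
@[simp] theorem cq_imK (w : ℂ) : (cq w).imK = 0 := rfl
@[simp] theorem toQuat_re (z : H3) : z.toQuat.re = z.x.re := rfl
@[simp] theorem toQuat_imI (z : H3) : z.toQuat.imI = z.x.im := rfl
@[simp] theorem toQuat_imJ (z : H3) : z.toQuat.imJ = z.y := rfl
@[simp] theorem toQuat_imK (z : H3) : z.toQuat.imK = 0 := rfl

theorem cq_add (v w : ℂ) : cq (v + w) = cq v + cq w := by
  ext <;> simp

theorem cq_mul (v w : ℂ) : cq (v * w) = cq v * cq w := by
  ext <;> simp

theorem denom_ne_zero {c d : ℂ} (h : c ≠ 0 ∨ d ≠ 0) (z : H3) : cq c * z.toQuat + cq d ≠ 0 := by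
  intro h0
  have hp := denomSq_pos h z
  have h1 := congrArg (fun q : ℍ[ℝ] => q.re) h0
  have h2 := congrArg (fun q : ℍ[ℝ] => q.imI) h0
  have h3 := congrArg (fun q : ℍ[ℝ] => q.imJ) h0
  have h4 := congrArg (fun q : ℍ[ℝ] => q.imK) h0
  simp at h1 h2 h3 h4
  have hy := z.y_pos.ne'
  have hc : c = 0 := by
    apply Complex.ext
    · rcases h3 with h | h
      · exact h
      · exact absurd h hy
    · rcases h4 with h | h
      · exact h
      · exact absurd h hy
  have hd : d = 0 := by
    apply Complex.ext
    · simpa [hc] using h1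
    · simpa [hc] using h2
  simp [denomSq, hc, hd] at hp

theorem toQuat_smul_mul (g : SL2C) (z : H3) :
    (g • z).toQuat * (cq (g.1 1 0) * z.toQuat + cq (g.1 1 1))
      = cq (g.1 0 0) * z.toQuat + cq (g.1 0 1) := by
  have hp := (denomSq_pos (bottom_row_ne_zero g) z).ne'
  have hdet := g.2
  rw [Matrix.det_fin_two] at hdet
  have hre := congrArg Complex.re hdet
  have him := congrArg Complex.im hdet
  have hx : (g • z).x.re = (((g.1 0 0 * z.x + g.1 0 1) * star (g.1 1 0 * z.x + g.1 1 1)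
            + g.1 0 0 * star (g.1 1 0) * (z.y : ℂ) ^ 2)).re / denomSq (g.1 1 0) (g.1 1 1) z := by
    rw [smul_x, Complex.div_ofReal_re]
  have hx' : (g • z).x.im = (((g.1 0 0 * z.x + g.1 0 1) * star (g.1 1 0 * z.x + g.1 1 1)
            + g.1 0 0 * star (g.1 1 0) * (z.y : ℂ) ^ 2)).im / denomSq (g.1 1 0) (g.1 1 1) z := by
    rw [smul_x, Complex.div_ofReal_im]
  have hy := smul_y g z
  have hD : denomSq (g.1 1 0) (g.1 1 1) z =
      Complex.normSq (g.1 1 0 * z.x + g.1 1 1) + Complex.normSq (g.1 1 0) * z.y ^ 2 := rfl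
  generalize denomSq (g.1 1 0) (g.1 1 1) z = D at *
  generalize g.1 0 0 = a at *
  generalize g.1 0 1 = b at *
  generalize g.1 1 0 = c at *
  generalize g.1 1 1 = d at *
  generalize g • z = w at *
  simp only [Complex.sub_re, Complex.sub_im, Complex.mul_re, Complex.mul_im, Complex.one_re,
    Complex.one_im] at hre him
  simp only [Complex.normSq_apply, Complex.add_re, Complex.add_im, Complex.mul_re,
    Complex.mul_im] at hD
  simp only [Complex.add_re, Complex.add_im, Complex.mul_re, Complex.mul_im, pow_two,
    RCLike.star_def, Complex.conj_re, Complex.conj_im, Complex.ofReal_re, Complex.ofReal_im]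
    at hx hx'
  ext
  all_goals
    simp [hx, hx', hy]
    field_simp
    subst hD
  · linear_combination (z.y ^ 2) * (c.re * hre + c.im * him)
  · linear_combination (z.y ^ 2) * (c.re * him - c.im * hre)
  · linear_combination (-z.y) * ((c.re * z.x.re - c.im * z.x.im + d.re) * hre
      + (c.re * z.x.im + c.im * z.x.re + d.im) * him)
  · linear_combination (-z.y) * ((c.re * z.x.re - c.im * z.x.im + d.re) * him
      - (c.re * z.x.im + c.im * z.x.re + d.im) * hre)

/-- `SL(2, ℂ)` acts on `H^3` by the quaternionic formula `g z = (a z + b) (c z + d)⁻¹`. -/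
theorem toQuat_smul (g : SL2C) (z : H3) :
    (g • z).toQuat = (cq (g.1 0 0) * z.toQuat + cq (g.1 0 1))
      * (cq (g.1 1 0) * z.toQuat + cq (g.1 1 1))⁻¹ := by
  rw [eq_mul_inv_iff_mul_eq₀ (denom_ne_zero (bottom_row_ne_zero g) z)]
  exact toQuat_smul_mul g z

instance : MulAction SL2C H3 where
  one_smul z := by
    apply toQuat_injective
    rw [toQuat_smul]
    have h1 : cq 1 = 1 := by ext <;> simp
    have h0 : cq 0 = 0 := by ext <;> simp
    simp [h1, h0]
  mul_smul g h z := by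
    apply toQuat_injective
    have hN := denom_ne_zero (bottom_row_ne_zero h) z
    have hG := denom_ne_zero (bottom_row_ne_zero g) (h • z)
    have hM := denom_ne_zero (bottom_row_ne_zero (g * h)) z
    have e := toQuat_smul_mul h z
    have key : ∀ i : Fin 2, cq ((g * h).1 i 0) * z.toQuat + cq ((g * h).1 i 1)
        = (cq (g.1 i 0) * (h • z).toQuat + cq (g.1 i 1))
          * (cq (h.1 1 0) * z.toQuat + cq (h.1 1 1)) := by
      intro i
      have e0 : ∀ j : Fin 2, (g * h).1 i j = g.1 i 0 * h.1 0 j + g.1 i 1 * h.1 1 j := by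
        intro j
        simp [Matrix.mul_apply, Fin.sum_univ_two]
      rw [add_mul, mul_assoc, e, e0, e0, cq_add, cq_add, cq_mul, cq_mul, cq_mul, cq_mul]
      noncomm_ring
    rw [toQuat_smul (g * h), toQuat_smul g (h • z), key 0, key 1, _root_.mul_inv_rev, mul_assoc,
      ← mul_assoc _ _ (cq (g.1 1 0) * (h • z).toQuat + cq (g.1 1 1))⁻¹, mul_inv_cancel₀ hN,
      one_mul]

/-! ## The group `conj⁻¹(SO(3, ℤ[i]))` -/

/-- The basis `X₁, X₂, Y` of `sl(2, ℂ)`, orthonormal for the half-trace form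
`B(X, Y) = Tr(XY) / 2`. -/
def slBasis : Fin 3 → Matrix (Fin 2) (Fin 2) ℂ :=
  ![!![0, 1; 1, 0], !![0, Complex.I; -Complex.I, 0], !![1, 0; 0, -1]]

/-- The half-trace form. -/
def halfTrace (X Y : Matrix (Fin 2) (Fin 2) ℂ) : ℂ := (X * Y).trace / 2

/-- The matrix, with respect to the orthonormal basis `slBasis`, of the conjugation
`X ↦ g X g⁻¹` on `sl(2, ℂ)`. -/
def conj (g : SL2C) : Matrix (Fin 3) (Fin 3) ℂ :=
  Matrix.of fun i j => halfTrace (slBasis i) (g.1 * slBasis j * (g⁻¹).1)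

theorem conj_eq (g : SL2C) {a b c d : ℂ} (hg : g.1 = !![a, b; c, d]) :
    conj g = !![(a ^ 2 - c ^ 2 + d ^ 2 - b ^ 2) / 2,
                  Complex.I * (a ^ 2 - c ^ 2 + b ^ 2 - d ^ 2) / 2, c * d - a * b;
                Complex.I * (b ^ 2 + d ^ 2 - a ^ 2 - c ^ 2) / 2,
                  (a ^ 2 + c ^ 2 + b ^ 2 + d ^ 2) / 2, Complex.I * (a * b + c * d);
                -(a * c) + b * d, -Complex.I * (a * c + b * d), a * d + b * c] := by
  have hI := Complex.I_sq
  ext i j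
  fin_cases i <;> fin_cases j <;>
    simp [conj, halfTrace, slBasis, hg, Matrix.adjugate_fin_two,
      Matrix.trace_fin_two] <;> (try ring_nf) <;> (try simp only [hI]) <;> (try ring)

theorem conj_spec (g : SL2C) (j : Fin 3) :
    g.1 * slBasis j * (g⁻¹).1 = ∑ i, conj g i j • slBasis i := by
  obtain ⟨a, b, c, d, hg⟩ : ∃ a b c d : ℂ, g.1 = !![a, b; c, d] :=
    ⟨_, _, _, _, Matrix.eta_fin_two g.1⟩
  have hI := Complex.I_sq
  rw [conj_eq g hg]
  ext k l
  fin_cases j <;> fin_cases k <;> fin_cases l <;>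
    simp [slBasis, hg, Fin.sum_univ_three, Matrix.adjugate_fin_two] <;> (try ring_nf) <;>
    (try simp only [hI]) <;> (try ring)

theorem slBasis_orthonormal (i j : Fin 3) :
    halfTrace (slBasis i) (slBasis j) = if i = j then 1 else 0 := by
  fin_cases i <;> fin_cases j <;>
    simp [halfTrace, slBasis, Matrix.trace_fin_two]

theorem conj_one : conj 1 = 1 := by
  rw [conj_eq 1 (a := 1) (b := 0) (c := 0) (d := 1) (Matrix.eta_fin_two _)]
  ext i j
  fin_cases i <;> fin_cases j <;> simp

theorem conj_mul (g h : SL2C) : conj (g * h) = conj g * conj h := by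
  ext i j
  have e : (g * h).1 * slBasis j * ((g * h)⁻¹).1
      = ∑ k, conj h k j • (g.1 * slBasis k * (g⁻¹).1) := by
    have : (g * h).1 * slBasis j * ((g * h)⁻¹).1
        = g.1 * (h.1 * slBasis j * (h⁻¹).1) * (g⁻¹).1 := by
      rw [_root_.mul_inv_rev]
      simp only [Matrix.SpecialLinearGroup.coe_mul, Matrix.mul_assoc]
    rw [this, conj_spec h j, Matrix.mul_sum, Matrix.sum_mul]
    simp
  have e2 : conj (g * h) i j = halfTrace (slBasis i) ((g * h).1 * slBasis j * ((g * h)⁻¹).1) :=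
    rfl
  rw [e2, e, Matrix.mul_apply]
  simp only [halfTrace, Matrix.mul_sum, Matrix.trace_sum, Finset.sum_div, Matrix.mul_smul,
    Matrix.trace_smul]
  refine Finset.sum_congr rfl fun k _ => ?_
  simp only [conj, halfTrace, Matrix.of_apply, smul_eq_mul]
  ring

/-- `Γ = conj⁻¹(SO(3, ℤ[i]))`, a subgroup of `SL(2, ℂ)`. -/
def Gam : Subgroup SL2C where
  carrier := {g | ∃ A ∈ Matrix.specialOrthogonalGroup (Fin 3) GaussianInt,
    conj g = A.map GaussianInt.toComplex}
  one_mem' := ⟨1, one_mem _, by rw [conj_one]; simp⟩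
  mul_mem' := by
    rintro g h ⟨A, hA, hg⟩ ⟨B, hB, hh⟩
    exact ⟨A * B, mul_mem hA hB, by rw [conj_mul, hg, hh, Matrix.map_mul]⟩
  inv_mem' := by
    rintro g ⟨A, hA, hg⟩
    have h1 : A * Aᵀ = 1 :=
      Matrix.mem_orthogonalGroup_iff (Fin 3) GaussianInt |>.1 (Matrix.mem_specialOrthogonalGroup_iff.1 hA).1
    have h2 : Aᵀ * A = 1 :=
      Matrix.mem_orthogonalGroup_iff' (Fin 3) GaussianInt |>.1 (Matrix.mem_specialOrthogonalGroup_iff.1 hA).1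
    refine ⟨Aᵀ, ?_, ?_⟩
    · rw [Matrix.mem_specialOrthogonalGroup_iff, Matrix.mem_orthogonalGroup_iff]
      refine ⟨by simpa using h2, ?_⟩
      rw [Matrix.det_transpose]
      exact (Matrix.mem_specialOrthogonalGroup_iff.1 hA).2
    · have h3 : conj g⁻¹ * conj g = 1 := by rw [← conj_mul, inv_mul_cancel, conj_one]
      have h4 : conj g * (Aᵀ).map GaussianInt.toComplex = 1 := by
        rw [hg, ← Matrix.map_mul, h1]
        simp
      calc conj g⁻¹ = conj g⁻¹ * (conj g * (Aᵀ).map GaussianInt.toComplex) := by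
            rw [h4, mul_one]
        _ = (Aᵀ).map GaussianInt.toComplex := by rw [← mul_assoc, h3, one_mul]

/-! ## The coordinates `φ` -/

/-- `φ = (φ₁, φ₂, φ₃) = (-log y, x₁, x₂) : H^3 → ℝ³`; the index is shifted to `0, 1, 2`. -/
def phi (z : H3) : EuclideanSpace ℝ (Fin 3) := !₂[-Real.log z.y, z.x.re, z.x.im]

/-- The inverse of `φ`: `φ⁻¹(t₁, t₂, t₃) = t₂ + t₃ i + e^{-t₁} j`. -/
def phiInv (t : EuclideanSpace ℝ (Fin 3)) : H3 := ⟨⟨t 1, t 2⟩, Real.exp (-t 0), Real.exp_pos _⟩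

theorem phiInv_phi (z : H3) : phiInv (phi z) = z := by
  apply H3.ext
  · apply Complex.ext <;> simp [phiInv, phi]
  · simp [phiInv, phi, Real.exp_log z.y_pos]

theorem phi_phiInv (t : EuclideanSpace ℝ (Fin 3)) : phi (phiInv t) = t := by
  ext i
  fin_cases i <;> simp [phiInv, phi]

/-- The projection `φ_{[2,3]} : H^3 → ℝ² = ℂ`. -/
def phi23 (z : H3) : ℂ := ⟨phi z 1, phi z 2⟩

/-- The zero section of `φ_{[2,3]}`: the first coordinate is `0`. -/
def sigma23 (w : ℂ) : H3 := phiInv !₂[0, w.re, w.im]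

/-! ## Fundamental domains, the axioms, good Grenier domains -/

/-- Let the group `H` (a subgroup of `G`) act on the space `X` by the maps `act γ`, with `N ≤ H`
acting trivially. `F` is a fundamental domain for the action of `N \ H` on `X`: its translates
cover `X`, and translates by distinct elements of `N \ H` meet only in the boundaries of both. -/
structure IsFundDomain {G X : Type*} [Group G] [TopologicalSpace X] (N H : Subgroup G)
    (act : G → X → X) (F : Set X) : Prop where
  cover : ∀ p : X, ∃ γ ∈ H, p ∈ act γ '' F
  inter : ∀ γ₁ ∈ H, ∀ γ₂ ∈ H, γ₁ * γ₂⁻¹ ∉ N →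
    act γ₁ '' F ∩ act γ₂ '' F ⊆ act γ₁ '' frontier F ∩ act γ₂ '' frontier F

section Axioms

variable (G : Type*) [Group G] [MulAction G H3]

/-- `Γ^{φ_{[1,j]}}`, for `0 ≤ j ≤ 3`: the elements whose action preserves the first `j`
`φ`-coordinates of all points. For `j = 0` it is `Γ`, for `j = 3` the kernel of the action. -/
def stab (j : ℕ) : Subgroup G where
  carrier := {γ | ∀ (z : H3) (i : Fin 3), i.val < j → phi (γ • z) i = phi z i}
  one_mem' := by
    intro z i _
    rw [one_smul]
  mul_mem' := by
    intro g h hg hh z i hi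
    rw [mul_smul, hg _ i hi, hh z i hi]
  inv_mem' := by
    intro g hg z i hi
    have := hg (g⁻¹ • z) i hi
    rw [smul_inv_smul] at this
    exact this.symm

/-- `f` is independent of the coordinates in `K`. -/
def IndependentOf (K : Set (Fin 3)) (f : H3 → ℝ) : Prop :=
  ∀ p q : H3, (∀ i, i ∉ K → phi p i = phi q i) → f p = f q

variable {G} in
/-- The difference function `Δ_{1,γ} = φ₁ φ⁻¹ - φ₁ γ φ⁻¹` on `ℝ³`. -/
def diffFun (γ : G) (t : EuclideanSpace ℝ (Fin 3)) : ℝ :=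
  phi (phiInv t) 0 - phi (γ • phiInv t) 0

/-- Axiom A1: for `j = 2, 3` and `γ ∈ Γ^{φ_{[1,j-1]}}`, `φ_j ∘ γ` does not depend on the first
`j - 1` coordinates. -/
def AxiomA1 : Prop :=
  ∀ j : Fin 3, j ≠ 0 → ∀ γ ∈ stab G j.val,
    IndependentOf {i | i < j} fun z => phi (γ • z) j

/-- Axiom A2: for `γ ∉ Γ^{φ₁}`, `Δ_{1,γ}` has no critical zeros. -/
def AxiomA2 : Prop :=
  ∀ γ : G, γ ∉ stab G 1 → ∀ t, ¬ (diffFun γ t = 0 ∧ fderiv ℝ (diffFun γ) t = 0)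

/-- Axiom A3: each point has, for each bound `B`, a neighbourhood `U` such that only finitely many
cosets `Γ^{φ₁} γ` satisfy `φ₁(Γ^{φ₁} γ U) ∩ (-∞, B] ≠ ∅`. -/
def AxiomA3 : Prop :=
  ∀ (z : H3) (B : ℝ), ∃ U ∈ 𝓝 z,
    {C : Set G | (∃ γ : G, C = (fun δ => δ * γ) '' (stab G 1 : Set G)) ∧
      ∃ g ∈ C, ∃ w ∈ U, phi (g • w) 0 ≤ B}.Finite

/-- Axiom A4: at each point there is a direction in which all `Δ_{1,γ}`, `γ ∉ Γ^{φ₁}`, have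
negative directional derivative. -/
def AxiomA4 : Prop :=
  ∀ z : H3, ∃ u : EuclideanSpace ℝ (Fin 3), ‖u‖ = 1 ∧
    ∀ γ : G, γ ∉ stab G 1 → lineDeriv ℝ (diffFun γ) (phi z) u < 0

variable {G} in
/-- The action of `Γ^{φ₁}` on `ℝ² = ℂ` induced, under A1, by the action on `H^3`. -/
def inducedAct (γ : G) (w : ℂ) : ℂ := phi23 (γ • sigma23 w)

/-- `F₁`: the points at which `φ₁` is minimal (so `y` is maximal) in the `Γ`-orbit. -/
def F1 : Set H3 := {z | ∀ γ : G, phi z 0 ≤ phi (γ • z) 0}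

/-- `F` is the good Grenier fundamental domain for the action of `Γ` on `H^3` associated to the
fundamental domain `D ⊆ ℝ² = ℂ`. -/
structure IsGoodGrenierDomain (D : Set ℂ) (F : Set H3) : Prop where
  a1 : AxiomA1 G
  a2 : AxiomA2 G
  a3 : AxiomA3 G
  a4 : AxiomA4 G
  base : IsFundDomain (stab G 3) (stab G 1) inducedAct D
  base_regular : D = closure (interior D)
  eq : F = phi23 ⁻¹' D ∩ F1 G
  fund : IsFundDomain (stab G 3) ⊤ (fun (γ : G) (z : H3) => γ • z) F

end Axioms

/-! ## The closure of `H^3`, convex hulls and polytopes -/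

/-- The closure `H^3 ∪ ℂ ∪ {∞}` of `H^3`: the one-point compactification of the closed upper
half-space. -/
abbrev H3bar : Type := OnePoint {p : ℂ × ℝ // 0 ≤ p.2}

/-- The inclusion of `H^3` into its closure. -/
def toBar (z : H3) : H3bar := OnePoint.some ⟨(z.x, z.y), z.y_pos.le⟩

/-- The hyperbolic distance of `H^3`, i.e. that of `ds² = (dx₁² + dx₂² + dy²) / y²`:
`cosh d(z, w) = 1 + (|x(z) - x(w)|² + (y(z) - y(w))²) / (2 y(z) y(w))`. -/
def hypDist (z w : H3) : ℝ :=
  Real.arcosh (1 + (‖z.x - w.x‖ ^ 2 + (z.y - w.y) ^ 2) / (2 * z.y * w.y))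

/-- A complete hyperbolic geodesic, parametrized by arc length and extended continuously to its
two endpoints at infinity. -/
def IsExtGeodesic (c : EReal → H3bar) : Prop :=
  Continuous c ∧ ∃ c₀ : ℝ → H3, (∀ t : ℝ, c t = toBar (c₀ t)) ∧
    ∀ s t : ℝ, hypDist (c₀ s) (c₀ t) = |s - t|

/-- The closed geodesic segment `[p, q]` in the closure of `H^3`. -/
def geodSegment (p q : H3bar) : Set H3bar :=
  {m | (m = p ∧ m = q) ∨ ∃ c, IsExtGeodesic c ∧ ∃ s t u : EReal,
    s ≤ t ∧ t ≤ u ∧ c s = p ∧ c t = m ∧ c u = q}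

def IsHypConvex (S : Set H3bar) : Prop := ∀ p ∈ S, ∀ q ∈ S, geodSegment p q ⊆ S

/-- The hyperbolic convex hull: the smallest convex set containing `S`. -/
def hypHull (S : Set H3bar) : Set H3bar := ⋂₀ {T | IsHypConvex T ∧ S ⊆ T}

theorem isHypConvex_hypHull (S : Set H3bar) : IsHypConvex (hypHull S) := by
  intro p hp q hq m hm T hT
  exact hT.1 p (hp T hT) q (hq T hT) hm

theorem subset_hypHull (S : Set H3bar) : S ⊆ hypHull S := fun _ hp _ hT => hT.2 hp

/-- The closed vertical half-plane over the line through `w` at angle `θ` to the real axis. -/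
def vertPlane (w : ℂ) (θ : ℝ) : Set H3bar :=
  insert OnePoint.infty (OnePoint.some ''
    {p | ∃ r : ℝ, p.1.1 = w + r * Complex.exp (θ * Complex.I)})

/-- The closed upper hemisphere with centre `w` and radius `r`. -/
def hemisphere (w : ℂ) (r : ℝ) : Set H3bar :=
  OnePoint.some '' {p | ‖p.1.1 - w‖ ^ 2 + p.1.2 ^ 2 = r ^ 2}

/-- The (closures of the) totally geodesic surfaces of `H^3`. -/
def IsTGSurface (S : Set H3bar) : Prop :=
  (∃ (w : ℂ) (θ : ℝ), S = vertPlane w θ) ∨ ∃ (w : ℂ) (r : ℝ), 0 < r ∧ S = hemisphere w r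

/-- `P` is the solid convex polytope with vertices at the `n` points `p i`, `n > 3`: the points
do not lie on a common totally geodesic surface, none of them is in the convex hull of the others,
and `P` is their convex hull. -/
structure IsSolidPolytope {n : ℕ} (p : Fin n → H3bar) (P : Set H3bar) : Prop where
  three_lt : 3 < n
  not_surface : ∀ S, IsTGSurface S → ¬ range p ⊆ S
  vertex : ∀ i, p i ∉ hypHull (p '' {k | k ≠ i})
  eq : P = hypHull (range p)

/-- The points `1 + √2 j`, `2 + j`, `1 + i + j`, `∞` of the closure of `H^3`. -/
def vertices : Fin 4 → H3bar :=
  ![toBar ⟨1, √2, by positivity⟩, toBar ⟨2, 1, one_pos⟩, toBar ⟨1 + Complex.I, 1, one_pos⟩,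
    OnePoint.infty]

/-- The Euclidean triangle with vertices `1`, `2`, `1 + i`. -/
def triangle : Set ℂ := convexHull ℝ {1, 2, 1 + Complex.I}

end

end Grenier

/-!
The polytope is `{∞}` together with the set `floorDomain` of points `x + y j` over the triangle with
vertices `1, 2, 1 + i` on or above the hemisphere `|x - 1|² + y² = 2`, and that set is the Grenier
domain.

*Convexity.* In the hyperboloid model a point `x + y j` has the light-cone coordinates
`1/y, x₁/y, x₂/y, (|x|² + y²)/y`, and `cosh` of the distance is the Minkowski product. Three points
at parameters `r, s, t` of a geodesic of unit speed have the degenerate Gram matrix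
`cosh (tᵢ - tⱼ)`, which forces the linear relation `linForm_geodesic` between them. Its
coefficients are nonnegative for `r ≤ s ≤ t`, so half-spaces are convex. An endpoint at `∞` is
dealt with by moving it to a far point of the geodesic, which lies in every half-space
`a + b₁ x₁ + b₂ x₂ + k (|x|² + y²) ≥ 0` with `k > 0`; the case `k = 0` is an intersection of such
half-spaces. Hence `{∞} ∪ floorDomain` is convex. It is the hull of its vertices since geodesics on a
hemisphere project to straight segments in `ℂ`, so that the floor is swept out by geodesics between
the three finite vertices, and the rest by vertical rays.

*Arithmetic.* For an element of `Γ` with bottom row `(c, d)`, the numbers `2 c²`, `2 c d`, `2 d²` and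
`c² + d²` are Gaussian integers, among other relations. Arguments modulo `1 + i` show that `c = 0`,
or `|c| ≥ 1`, or `|c|² = 1/2` and `-d/c ∈ 1 + (1 + i) ℤ[i]` (`row_of_mem_Gam`), and that the
elements with `c = 0` act on `ℂ` by `x ↦ u x + m` with `u⁴ = 1` and `m ∈ (1 + i) ℤ[i]`
(`upper_of_mem_Gam`). All these maps occur, and the triangle is a fundamental domain for them.

*The domain.* The height of `γ z` is `y / (|c x + d|² + |c|² y²)`. Over the triangle `1` is the
nearest point of `1 + (1 + i) ℤ[i]`, so the denominator is at least `1` for all `γ` if and only if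
`|x - 1|² + y² ≥ 2` (`floorDomain_eq_inter_F1`). Finiteness of the set of bottom rows with bounded
denominator gives A3 and a highest point in each orbit; a `γ` with `c ≠ 0` that maps a point of the
domain into the domain has denominator `1` there, and the denominator is strictly increasing in `y`,
which puts the point on the boundary. The same monotonicity gives A2 and A4.
-/

namespace Grenier

open Matrix Set Topology Filter
open scoped Quaternion

/-! ### The topology of the closure of hyperbolic space -/

theorem toBar_injective : Function.Injective toBar := by
  intro z w h
  have h' := Subtype.ext_iff.1 (OnePoint.coe_injective h)
  exact H3.ext (congrArg Prod.fst h') (congrArg Prod.snd h')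

theorem toBar_ne_infty (z : H3) : toBar z ≠ OnePoint.infty := OnePoint.coe_ne_infty _

theorem tendsto_coe_infty_iff {ι : Type*} {l : Filter ι} {f : ι → {p : ℂ × ℝ // 0 ≤ p.2}} :
    Tendsto (fun i => (OnePoint.some (f i) : H3bar)) l (𝓝 OnePoint.infty) ↔
      Tendsto (fun i => ‖(f i).1‖) l atTop := by
  have hcl : IsClosed {p : ℂ × ℝ | 0 ≤ p.2} := isClosed_le continuous_const continuous_snd
  have : ProperSpace {p : ℂ × ℝ // 0 ≤ p.2} := ProperSpace.of_isClosed hcl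
  have h1 : Tendsto (fun i => (OnePoint.some (f i) : H3bar)) l (𝓝 OnePoint.infty) ↔
      Tendsto f l (Bornology.cobounded _) := by
    rw [Metric.cobounded_eq_cocompact, ← coclosedCompact_eq_cocompact,
      ← OnePoint.comap_coe_nhds_infty, tendsto_comap_iff]
    rfl
  rw [h1, ← Metric.tendsto_dist_right_atTop_iff (⟨0, le_rfl⟩ : {p : ℂ × ℝ // 0 ≤ p.2})]
  have : ∀ i, dist (f i) ⟨0, le_rfl⟩ = ‖(f i).1‖ := fun i => by
    rw [Subtype.dist_eq, dist_zero_right]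
  simp only [this]

theorem tendsto_toBar_iff {ι : Type*} {l : Filter ι} {f : ι → H3} {z : H3} :
    Tendsto (fun i => toBar (f i)) l (𝓝 (toBar z)) ↔
      Tendsto (fun i => ((f i).x, (f i).y)) l (𝓝 (z.x, z.y)) := by
  have h := (OnePoint.isOpenEmbedding_coe (X := {p : ℂ × ℝ // 0 ≤ p.2})).isEmbedding
  refine (h.tendsto_nhds_iff (f := fun i => (⟨((f i).x, (f i).y), (f i).y_pos.le⟩ :
    {p : ℂ × ℝ // 0 ≤ p.2}))).symm.trans tendsto_subtype_rng

theorem continuous_toBar : Continuous toBar :=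
  OnePoint.continuous_coe.comp (continuous_induced_dom.subtype_mk _)

theorem continuous_of_real_of_tendsto {Y : Type*} [TopologicalSpace Y] {c : EReal → Y}
    (h : Continuous fun t : ℝ => c t) (htop : Tendsto (fun t : ℝ => c t) atTop (𝓝 (c ⊤)))
    (hbot : Tendsto (fun t : ℝ => c t) atBot (𝓝 (c ⊥))) : Continuous c := by
  rw [continuous_iff_continuousAt]
  intro t
  induction t using EReal.rec with
  | coe t => exact (EReal.isOpenEmbedding_coe.continuousAt_iff).1 h.continuousAt
  | top =>
    intro V hV
    obtain ⟨a, ha⟩ := eventually_atTop.1 (htop hV)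
    refine EReal.nhds_top_basis.mem_iff.2 ⟨a, trivial, fun s hs => ?_⟩
    induction s using EReal.rec with
    | coe s => exact ha s (EReal.coe_lt_coe_iff.1 hs).le
    | top => exact mem_of_mem_nhds (X := Y) hV
    | bot => exact absurd (mem_Ioi.1 hs) not_lt_bot
  | bot =>
    intro V hV
    obtain ⟨a, ha⟩ := eventually_atBot.1 (hbot hV)
    refine EReal.nhds_bot_basis.mem_iff.2 ⟨a, trivial, fun s hs => ?_⟩
    induction s using EReal.rec with
    | coe s => exact ha s (EReal.coe_lt_coe_iff.1 hs).le
    | top => exact absurd (mem_Iio.1 hs) not_top_lt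
    | bot => exact mem_of_mem_nhds (X := Y) hV

/-! ### Geodesics in the hyperboloid model -/

theorem cosh_hypDist (z w : H3) : Real.cosh (hypDist z w) =
    1 + (‖z.x - w.x‖ ^ 2 + (z.y - w.y) ^ 2) / (2 * z.y * w.y) := by
  have := z.y_pos
  have := w.y_pos
  refine Real.cosh_arcosh ?_
  have : 0 ≤ (‖z.x - w.x‖ ^ 2 + (z.y - w.y) ^ 2) / (2 * z.y * w.y) := by positivity
  linarith

theorem hypDist_eq_of_cosh {z w : H3} {d : ℝ}
    (h : 1 + (‖z.x - w.x‖ ^ 2 + (z.y - w.y) ^ 2) / (2 * z.y * w.y) = Real.cosh d) :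
    hypDist z w = |d| := by
  rw [hypDist, h, ← Real.cosh_abs, Real.arcosh_cosh (abs_nonneg d)]

/-- A vector of Minkowski space which is null and orthogonal to a timelike vector vanishes; the
quadratic form is `p r - q₁² - q₂²`. -/
theorem eq_zero_of_null_of_orthogonal {p q₁ q₂ r P Q₁ Q₂ R : ℝ} (hX : p * r = 1 + q₁ ^ 2 + q₂ ^ 2)
    (hWX : P * r + R * p = 2 * (q₁ * Q₁ + q₂ * Q₂))
    (hWW : P * R = Q₁ ^ 2 + Q₂ ^ 2) : P = 0 ∧ Q₁ = 0 ∧ Q₂ = 0 ∧ R = 0 := by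
  have h1 : (P * r + R * p) ^ 2 - 4 * (P * R) * (p * r) = (P * r - R * p) ^ 2 := by ring
  rw [hWX, hWW, hX] at h1
  have h2 : Q₁ ^ 2 + Q₂ ^ 2 = -(q₁ * Q₂ - q₂ * Q₁) ^ 2 - ((P * r - R * p) / 2) ^ 2 := by
    linear_combination (-1 / 4) * h1
  have h3 : Q₁ ^ 2 + Q₂ ^ 2 ≤ 0 := by
    rw [h2]
    nlinarith [sq_nonneg (q₁ * Q₂ - q₂ * Q₁), sq_nonneg ((P * r - R * p) / 2)]
  have hQ₁ : Q₁ = 0 := by nlinarith [sq_nonneg Q₁, sq_nonneg Q₂]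
  have hQ₂ : Q₂ = 0 := by nlinarith [sq_nonneg Q₁, sq_nonneg Q₂]
  subst hQ₁ hQ₂
  have hp : p ≠ 0 := by
    rintro rfl
    nlinarith [sq_nonneg q₁, sq_nonneg q₂]
  have hr : r ≠ 0 := by
    rintro rfl
    nlinarith [sq_nonneg q₁, sq_nonneg q₂]
  have h4 : P * r = -(R * p) := by linarith
  have hPR : P * R = 0 := by simpa using hWW
  rcases mul_eq_zero.1 hPR with h | h
  · subst h
    refine ⟨rfl, rfl, rfl, ?_⟩
    have : R * p = 0 := by linarith
    exact (mul_eq_zero.1 this).resolve_right hp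
  · subst h
    refine ⟨?_, rfl, rfl, rfl⟩
    have : P * r = 0 := by linarith
    exact (mul_eq_zero.1 this).resolve_right hr

/-- The value at `z`, as a point of the hyperboloid, of the linear form with coefficients
`a, b₁, b₂, k` in the light-cone coordinates `1/y, x₁/y, x₂/y, (|x|² + y²)/y`. -/
noncomputable def linForm (a b₁ b₂ k : ℝ) (z : H3) : ℝ :=
  (a + b₁ * z.x.re + b₂ * z.x.im + k * (z.x.re ^ 2 + z.x.im ^ 2 + z.y ^ 2)) / z.y

/-- On a geodesic of unit speed the points of the hyperboloid stay in a plane through the origin: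
the Gram matrix `cosh (tᵢ - tⱼ)` of any three of them is degenerate. -/
theorem linForm_geodesic {c : ℝ → H3} (hc : ∀ s t : ℝ, hypDist (c s) (c t) = |s - t|)
    (a b₁ b₂ k r s t : ℝ) :
    linForm a b₁ b₂ k (c s) * Real.sinh (t - r) =
      linForm a b₁ b₂ k (c r) * Real.sinh (t - s) + linForm a b₁ b₂ k (c t) * Real.sinh (s - r) := by
  have gram : ∀ s t : ℝ, linForm 1 0 0 0 (c s) * linForm 0 0 0 1 (c t) +
      linForm 0 0 0 1 (c s) * linForm 1 0 0 0 (c t) -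
      2 * (linForm 0 1 0 0 (c s) * linForm 0 1 0 0 (c t)
        + linForm 0 0 1 0 (c s) * linForm 0 0 1 0 (c t)) = 2 * Real.cosh (s - t) := by
    intro s t
    have h := cosh_hypDist (c s) (c t)
    rw [hc, Real.cosh_abs] at h
    rw [h, ← Complex.normSq_eq_norm_sq, Complex.normSq_apply, Complex.sub_re, Complex.sub_im]
    have h1 := (c s).y_pos.ne'
    have h2 := (c t).y_pos.ne'
    simp only [linForm]
    field_simp
    ring
  have hl : ∀ z, linForm a b₁ b₂ k z = a * linForm 1 0 0 0 z + b₁ * linForm 0 1 0 0 z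
      + b₂ * linForm 0 0 1 0 z + k * linForm 0 0 0 1 z := by
    intro z
    simp only [linForm]
    ring
  have grr := gram r r
  have gss := gram s s
  have gtt := gram t t
  have gsr := gram s r
  have gtr := gram t r
  have gts := gram t s
  rw [sub_self, Real.cosh_zero] at grr gss gtt
  have e1 : Real.sinh (t - r) = Real.sinh (t - s) * Real.cosh (s - r)
      + Real.cosh (t - s) * Real.sinh (s - r) := by rw [← Real.sinh_add]; ring_nf
  have e2 : Real.cosh (t - r) = Real.cosh (t - s) * Real.cosh (s - r)
      + Real.sinh (t - s) * Real.sinh (s - r) := by rw [← Real.cosh_add]; ring_nf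
  have e3 := Real.cosh_sq (t - s)
  have e4 := Real.cosh_sq (s - r)
  rw [hl, hl (c r), hl (c t)]
  rw [e2] at gtr
  rw [e1]
  generalize Real.sinh (t - s) = S₁ at *
  generalize Real.cosh (t - s) = C₁ at *
  generalize Real.sinh (s - r) = S₂ at *
  generalize Real.cosh (s - r) = C₂ at *
  generalize linForm 1 0 0 0 (c r) = pr at *
  generalize linForm 0 1 0 0 (c r) = qr at *
  generalize linForm 0 0 1 0 (c r) = ur at *
  generalize linForm 0 0 0 1 (c r) = rr at *
  generalize linForm 1 0 0 0 (c s) = ps at *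
  generalize linForm 0 1 0 0 (c s) = qs at *
  generalize linForm 0 0 1 0 (c s) = us at *
  generalize linForm 0 0 0 1 (c s) = rs at *
  generalize linForm 1 0 0 0 (c t) = pt at *
  generalize linForm 0 1 0 0 (c t) = qt at *
  generalize linForm 0 0 1 0 (c t) = ut at *
  generalize linForm 0 0 0 1 (c t) = rt at *
  obtain ⟨h1, h2, h3, h4⟩ := eq_zero_of_null_of_orthogonal
    (p := ps) (q₁ := qs) (q₂ := us) (r := rs)
    (P := (S₁ * C₂ + C₁ * S₂) * ps - S₁ * pr - S₂ * pt)
    (Q₁ := (S₁ * C₂ + C₁ * S₂) * qs - S₁ * qr - S₂ * qt)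
    (Q₂ := (S₁ * C₂ + C₁ * S₂) * us - S₁ * ur - S₂ * ut)
    (R := (S₁ * C₂ + C₁ * S₂) * rs - S₁ * rr - S₂ * rt)
    (by linear_combination gss / 2)
    (by linear_combination (S₁ * C₂ + C₁ * S₂) * gss - S₁ * gsr - S₂ * gts)
    (by
      linear_combination (S₁ * C₂ + C₁ * S₂) ^ 2 * gss / 2 + S₁ ^ 2 * grr / 2 + S₂ ^ 2 * gtt / 2
        - (S₁ * C₂ + C₁ * S₂) * S₁ * gsr - (S₁ * C₂ + C₁ * S₂) * S₂ * gts + S₁ * S₂ * gtr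
        - S₂ ^ 2 * e3 - S₁ ^ 2 * e4)
  linear_combination a * h1 + b₁ * h2 + b₂ * h3 + k * h4

/-! ### Convexity of half-spaces -/

/-- The closed half-space `a + b₁ x₁ + b₂ x₂ + k (|x|² + y²) ≥ 0` of `H^3`: a side of a vertical
plane if `k = 0`, and otherwise the exterior (`k > 0`) or interior (`k < 0`) of a hemisphere. -/
def halfSpace (a b₁ b₂ k : ℝ) : Set H3 :=
  {z | 0 ≤ a + b₁ * z.x.re + b₂ * z.x.im + k * (z.x.re ^ 2 + z.x.im ^ 2 + z.y ^ 2)}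

theorem mem_halfSpace_iff_linForm {a b₁ b₂ k : ℝ} {z : H3} :
    z ∈ halfSpace a b₁ b₂ k ↔ 0 ≤ linForm a b₁ b₂ k z :=
  ⟨fun h => div_nonneg h z.y_pos.le, fun h => by
    simpa [halfSpace, linForm, div_mul_cancel₀ _ z.y_pos.ne'] using mul_nonneg h z.y_pos.le⟩

theorem mem_halfSpace_of_mem_of_mem {c : ℝ → H3}
    (hc : ∀ s t : ℝ, hypDist (c s) (c t) = |s - t|) {a b₁ b₂ k r s t : ℝ} (hrs : r ≤ s)
    (hst : s ≤ t) (hr : c r ∈ halfSpace a b₁ b₂ k) (ht : c t ∈ halfSpace a b₁ b₂ k) :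
    c s ∈ halfSpace a b₁ b₂ k := by
  rcases (hrs.trans hst).eq_or_lt with h | h
  · obtain rfl : s = r := le_antisymm (h ▸ hst) hrs
    exact hr
  rw [mem_halfSpace_iff_linForm] at *
  have h1 : 0 < Real.sinh (t - r) := Real.sinh_pos_iff.2 (sub_pos.2 h)
  refine nonneg_of_mul_nonneg_left ?_ h1
  rw [linForm_geodesic hc]
  have h2 := Real.sinh_nonneg_iff.2 (sub_nonneg.2 hst)
  have h3 := Real.sinh_nonneg_iff.2 (sub_nonneg.2 hrs)
  positivity

theorem IsExtGeodesic.comp_neg {c : EReal → H3bar} (hc : IsExtGeodesic c) :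
    IsExtGeodesic fun t => c (-t) := by
  obtain ⟨hcont, c₀, h₀, hd⟩ := hc
  refine ⟨hcont.comp continuous_neg, fun t => c₀ (-t), fun t => ?_, fun s t => ?_⟩
  · rw [← h₀, EReal.coe_neg]
  · rw [hd, ← abs_neg]
    ring_nf

theorem tendsto_coe_atTop_nhds_top : Tendsto (fun t : ℝ => (t : EReal)) atTop (𝓝 ⊤) := by
  rw [EReal.tendsto_nhds_top_iff_real]
  intro x
  filter_upwards [eventually_gt_atTop x] with t ht
  exact EReal.coe_lt_coe_iff.2 ht

/-- The upper end of a geodesic is a point at infinity, since the distance from `c 0` to `c t`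
tends to infinity. -/
theorem IsExtGeodesic.top_ne_toBar {c : EReal → H3bar} (hc : IsExtGeodesic c) (z : H3) :
    c ⊤ ≠ toBar z := by
  obtain ⟨hcont, c₀, h₀, hd⟩ := hc
  intro h
  have h1 : Tendsto (fun t : ℝ => toBar (c₀ t)) atTop (𝓝 (toBar z)) := by
    simp only [← h₀, ← h]
    exact (hcont.tendsto ⊤).comp tendsto_coe_atTop_nhds_top
  rw [tendsto_toBar_iff] at h1
  have hz := z.y_pos
  have hw := (c₀ 0).y_pos
  have h2 : ContinuousAt (fun p : ℂ × ℝ =>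
      1 + (‖(c₀ 0).x - p.1‖ ^ 2 + ((c₀ 0).y - p.2) ^ 2) / (2 * (c₀ 0).y * p.2)) (z.x, z.y) := by
    refine continuousAt_const.add (ContinuousAt.div (by fun_prop) (by fun_prop) ?_)
    simp only
    positivity
  have h3 := h2.tendsto.comp h1
  refine not_tendsto_nhds_of_tendsto_atTop (f := Real.cosh) ?_ _ (h3.congr fun t => ?_)
  · refine tendsto_atTop_mono (f := fun t => Real.exp t / 2) (fun t => ?_)
      (Real.tendsto_exp_atTop.atTop_div_const two_pos)
    rw [Real.cosh_eq]
    have := Real.exp_pos (-t)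
    linarith
  · simp only [Function.comp]
    rw [← cosh_hypDist, hd, Real.cosh_abs, zero_sub, Real.cosh_neg]

theorem eventually_mem_halfSpace_of_tendsto_infty {ι : Type*} {l : Filter ι} {f : ι → H3}
    (h : Tendsto (fun i => toBar (f i)) l (𝓝 OnePoint.infty)) {a b₁ b₂ k : ℝ} (hk : 0 < k) :
    ∀ᶠ i in l, f i ∈ halfSpace a b₁ b₂ k := by
  have h1 := tendsto_coe_infty_iff.1 h
  set R : ℝ := 1 + 2 / k * ((b₁ ^ 2 + b₂ ^ 2) / (2 * k) + |a|) with hR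
  have hR1 : 1 ≤ R := by
    have : 0 ≤ 2 / k * ((b₁ ^ 2 + b₂ ^ 2) / (2 * k) + |a|) := by positivity
    linarith
  filter_upwards [h1.eventually_ge_atTop R] with i hi
  have h2 : R ≤ ‖(f i).x‖ ^ 2 + (f i).y ^ 2 := by
    rcases le_max_iff.1 (show R ≤ max ‖(f i).x‖ ‖(f i).y‖ from hi) with h | h
    · nlinarith [sq_nonneg (f i).y]
    · rw [Real.norm_of_nonneg (f i).y_pos.le] at h
      nlinarith [sq_nonneg ‖(f i).x‖]
  rw [← Complex.normSq_eq_norm_sq, Complex.normSq_apply] at h2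
  rw [halfSpace, mem_ofPred_eq]
  have h3 : k / 2 * R = k / 2 + (b₁ ^ 2 + b₂ ^ 2) / (2 * k) + |a| := by
    rw [hR]
    field_simp
    ring
  have h4 := mul_le_mul_of_nonneg_left h2 (half_pos hk).le
  have h5 : 0 ≤ ((f i).x.re + b₁ / k) ^ 2 * (k / 2) + ((f i).x.im + b₂ / k) ^ 2 * (k / 2) := by
    positivity
  have h6 : ((f i).x.re + b₁ / k) ^ 2 * (k / 2) + ((f i).x.im + b₂ / k) ^ 2 * (k / 2)
      = k / 2 * ((f i).x.re ^ 2 + (f i).x.im ^ 2) + b₁ * (f i).x.re + b₂ * (f i).x.im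
        + (b₁ ^ 2 + b₂ ^ 2) / (2 * k) := by
    field_simp
    ring
  have h7 : 0 ≤ k / 2 * (f i).y ^ 2 := by positivity
  have := neg_abs_le a
  nlinarith

theorem IsExtGeodesic.exists_ge_mem_halfSpace {c : EReal → H3bar} (hc : IsExtGeodesic c)
    {c₀ : ℝ → H3} (h₀ : ∀ t : ℝ, c t = toBar (c₀ t)) {a b₁ b₂ k : ℝ} {u : EReal} {t : ℝ}
    (htu : (t : EReal) ≤ u)
    (hu : c u ∈ toBar '' halfSpace a b₁ b₂ k ∨ c u = OnePoint.infty ∧ 0 < k) :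
    ∃ t' ≥ t, c₀ t' ∈ halfSpace a b₁ b₂ k := by
  induction u using EReal.rec with
  | bot => exact absurd htu (not_le.2 (EReal.bot_lt_coe t))
  | coe u =>
    rw [h₀] at hu
    rcases hu with ⟨z, hz, h⟩ | h
    · exact ⟨u, EReal.coe_le_coe_iff.1 htu, toBar_injective h ▸ hz⟩
    · exact absurd h.1 (toBar_ne_infty _)
  | top =>
    rcases hu with ⟨z, hz, h⟩ | ⟨h, hk⟩
    · exact absurd h.symm (hc.top_ne_toBar z)
    · have h1 : Tendsto (fun t : ℝ => toBar (c₀ t)) atTop (𝓝 OnePoint.infty) := by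
        simp only [← h₀, ← h]
        exact (hc.1.tendsto ⊤).comp tendsto_coe_atTop_nhds_top
      obtain ⟨t', h2, h3⟩ := ((eventually_mem_halfSpace_of_tendsto_infty h1 hk).and
        (eventually_ge_atTop t)).exists
      exact ⟨t', h3, h2⟩

theorem mem_of_mem_geodSegment {a b₁ b₂ k : ℝ} {p q m : H3bar}
    (hp : p ∈ toBar '' halfSpace a b₁ b₂ k ∨ p = OnePoint.infty ∧ 0 < k)
    (hq : q ∈ toBar '' halfSpace a b₁ b₂ k ∨ q = OnePoint.infty ∧ 0 < k)
    (hm : m ∈ geodSegment p q) :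
    m = p ∨ m = q ∨ m ∈ toBar '' halfSpace a b₁ b₂ k := by
  rcases hm with ⟨rfl, -⟩ | ⟨c, hc, s, t, u, hst, htu, rfl, rfl, rfl⟩
  · exact Or.inl rfl
  induction t using EReal.rec with
  | bot => exact Or.inl (by rw [le_bot_iff.1 hst])
  | top => exact Or.inr (Or.inl (by rw [top_le_iff.1 htu]))
  | coe t =>
    obtain ⟨c₀, h₀, hd⟩ := hc.2
    obtain ⟨t₁, ht₁, h₁⟩ := hc.exists_ge_mem_halfSpace h₀ htu hq
    obtain ⟨t₂, ht₂, h₂⟩ := hc.comp_neg.exists_ge_mem_halfSpace (c₀ := fun t => c₀ (-t))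
      (u := -s) (t := -t) (fun t => by rw [← h₀, EReal.coe_neg])
      (by rw [EReal.coe_neg]; exact EReal.neg_le_neg_iff.2 hst) (by simpa using hp)
    exact Or.inr (Or.inr ⟨c₀ t, mem_halfSpace_of_mem_of_mem hd (by linarith) ht₁ h₂ h₁, (h₀ t).symm⟩)

theorem isHypConvex_image_halfSpace (a b₁ b₂ k : ℝ) :
    IsHypConvex (toBar '' halfSpace a b₁ b₂ k) := by
  intro p hp q hq m hm
  rcases mem_of_mem_geodSegment (Or.inl hp) (Or.inl hq) hm with rfl | rfl | h
  exacts [hp, hq, h]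

theorem IsHypConvex.sInter {𝒮 : Set (Set H3bar)} (h : ∀ S ∈ 𝒮, IsHypConvex S) :
    IsHypConvex (⋂₀ 𝒮) :=
  fun p hp q hq _ hm S hS => h S hS p (hp S hS) q (hq S hS) hm

theorem IsHypConvex.inter {S T : Set H3bar} (hS : IsHypConvex S) (hT : IsHypConvex T) :
    IsHypConvex (S ∩ T) :=
  fun p hp q hq _ hm => ⟨hS p hp.1 q hq.1 hm, hT p hp.2 q hq.2 hm⟩

theorem isHypConvex_insert_infty_halfSpace_of_pos (a b₁ b₂ : ℝ) {k : ℝ} (hk : 0 < k) :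
    IsHypConvex (insert OnePoint.infty (toBar '' halfSpace a b₁ b₂ k)) := by
  have key : ∀ p ∈ insert OnePoint.infty (toBar '' halfSpace a b₁ b₂ k),
      p ∈ toBar '' halfSpace a b₁ b₂ k ∨ p = OnePoint.infty ∧ 0 < k := by
    rintro p (rfl | h)
    exacts [Or.inr ⟨rfl, hk⟩, Or.inl h]
  intro p hp q hq m hm
  rcases mem_of_mem_geodSegment (key p hp) (key q hq) hm with rfl | rfl | h
  exacts [hp, hq, Or.inr h]

theorem infty_toBar_mem_insert {S : Set H3} {z : H3} :
    toBar z ∈ insert OnePoint.infty (toBar '' S) ↔ z ∈ S := by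
  rw [mem_insert_iff, or_iff_right (toBar_ne_infty z), toBar_injective.mem_set_image]

/-- A side of a vertical plane, as the intersection over `ε > 0` of the exteriors of hemispheres
with equation `a + b₁ x₁ + b₂ x₂ + ε (|x|² + y²) = 0`. -/
theorem insert_infty_halfSpace_zero (a b₁ b₂ : ℝ) :
    insert OnePoint.infty (toBar '' halfSpace a b₁ b₂ 0) =
      ⋂₀ {S | ∃ ε > 0, S = insert OnePoint.infty (toBar '' halfSpace a b₁ b₂ ε)} := by
  ext p
  constructor
  · rintro (rfl | ⟨z, hz, rfl⟩) S ⟨ε, hε, rfl⟩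
    · exact mem_insert _ _
    · refine Or.inr ⟨z, ?_, rfl⟩
      simp only [halfSpace, mem_ofPred_eq] at hz ⊢
      have : 0 ≤ ε * (z.x.re ^ 2 + z.x.im ^ 2 + z.y ^ 2) := by positivity
      linarith
  · intro h
    by_cases hp : p = OnePoint.infty
    · exact Or.inl hp
    obtain ⟨z, -, rfl⟩ := (h _ ⟨1, one_pos, rfl⟩).resolve_left hp
    refine Or.inr ⟨z, ?_, rfl⟩
    have h1 : ∀ ε > 0, z ∈ halfSpace a b₁ b₂ ε := fun ε hε =>
      infty_toBar_mem_insert.1 (h _ ⟨ε, hε, rfl⟩)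
    simp only [halfSpace, mem_ofPred_eq] at h1 ⊢
    have hN : 0 < z.x.re ^ 2 + z.x.im ^ 2 + z.y ^ 2 := by
      have := z.y_pos
      positivity
    refine le_of_forall_pos_le_add fun δ hδ => ?_
    have := h1 (δ / (z.x.re ^ 2 + z.x.im ^ 2 + z.y ^ 2)) (div_pos hδ hN)
    rw [div_mul_cancel₀ _ hN.ne'] at this
    linarith

theorem isHypConvex_insert_infty_halfSpace (a b₁ b₂ : ℝ) {k : ℝ} (hk : 0 ≤ k) :
    IsHypConvex (insert OnePoint.infty (toBar '' halfSpace a b₁ b₂ k)) := by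
  rcases hk.eq_or_lt with rfl | hk
  · rw [insert_infty_halfSpace_zero]
    refine IsHypConvex.sInter ?_
    rintro S ⟨ε, hε, rfl⟩
    exact isHypConvex_insert_infty_halfSpace_of_pos a b₁ b₂ hε
  · exact isHypConvex_insert_infty_halfSpace_of_pos a b₁ b₂ hk

/-! ### Geodesic segments -/

/-- Points on or above `z` on a vertical line lie on the segment from `z` to `∞`. -/
theorem toBar_mem_geodSegment_infty {z w : H3} (hx : w.x = z.x) (hy : z.y ≤ w.y) :
    toBar w ∈ geodSegment (toBar z) OnePoint.infty := by
  classical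
  set c₀ : ℝ → H3 := fun t => ⟨z.x, Real.exp t, Real.exp_pos t⟩ with hc₀
  set c : EReal → H3bar := fun t => if t = ⊤ then OnePoint.infty else
    if t = ⊥ then OnePoint.some ⟨(z.x, 0), le_rfl⟩ else toBar (c₀ t.toReal) with hcdef
  have h₀ : ∀ t : ℝ, c t = toBar (c₀ t) := fun t => by
    simp [hcdef, EReal.coe_ne_top, EReal.coe_ne_bot]
  have htop : c ⊤ = OnePoint.infty := by simp [hcdef]
  have hbot : c ⊥ = OnePoint.some ⟨(z.x, 0), le_rfl⟩ := by simp [hcdef]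
  have hc : IsExtGeodesic c := by
    refine ⟨continuous_of_real_of_tendsto ?_ ?_ ?_, c₀, h₀, fun s t => ?_⟩
    · simp only [h₀]
      refine continuous_toBar.comp (continuous_induced_rng.2 ?_)
      exact continuous_const.prodMk Real.continuous_exp
    · simp only [h₀, htop]
      refine tendsto_coe_infty_iff.2 (tendsto_atTop_mono (fun t => ?_) Real.tendsto_exp_atTop)
      exact (le_abs_self _).trans (le_max_right _ _)
    · simp only [h₀, hbot]
      refine OnePoint.continuous_coe.continuousAt.tendsto.comp (tendsto_subtype_rng.2 ?_)
      exact tendsto_const_nhds.prodMk_nhds Real.tendsto_exp_atBot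
    · refine hypDist_eq_of_cosh ?_
      simp only [hc₀, sub_self, norm_zero]
      rw [Real.cosh_eq, neg_sub, Real.exp_sub, Real.exp_sub]
      have h1 := Real.exp_pos s
      have h2 := Real.exp_pos t
      field_simp
      ring
  refine Or.inr ⟨c, hc, Real.log z.y, Real.log w.y, ⊤, ?_, le_top, ?_, ?_, htop⟩
  · exact EReal.coe_le_coe_iff.2 (Real.log_le_log z.y_pos hy)
  · rw [h₀]
    exact congrArg toBar (H3.ext rfl (Real.exp_log z.y_pos))
  · rw [h₀]
    exact congrArg toBar (H3.ext hx.symm (Real.exp_log w.y_pos))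

/-- The geodesic with centre `e`, horizontal direction `u` and radius `ρ` is
`t ↦ e + ρ tanh t u + ρ / cosh t j`. -/
theorem isExtGeodesic_semicircle (e u : ℂ) (hu : ‖u‖ = 1) {ρ : ℝ} (hρ : 0 < ρ) :
    ∃ c : EReal → H3bar, IsExtGeodesic c ∧ ∀ t : ℝ,
      c t = toBar ⟨e + (ρ * Real.tanh t : ℝ) * u, ρ / Real.cosh t,
        div_pos hρ (Real.cosh_pos t)⟩ := by
  classical
  set c₀ : ℝ → H3 := fun t => ⟨e + (ρ * Real.tanh t : ℝ) * u, ρ / Real.cosh t,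
        div_pos hρ (Real.cosh_pos t)⟩ with hc₀
  set c : EReal → H3bar := fun t => if t = ⊤ then OnePoint.some ⟨(e + (ρ * 1 : ℝ) * u, 0), le_rfl⟩
    else if t = ⊥ then OnePoint.some ⟨(e + (ρ * -1 : ℝ) * u, 0), le_rfl⟩
    else toBar (c₀ t.toReal) with hcdef
  have h₀ : ∀ t : ℝ, c t = toBar (c₀ t) := fun t => by
    simp [hcdef, EReal.coe_ne_top, EReal.coe_ne_bot]
  have htop : c ⊤ = OnePoint.some ⟨(e + (ρ * 1 : ℝ) * u, 0), le_rfl⟩ := by simp [hcdef]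
  have hbot : c ⊥ = OnePoint.some ⟨(e + (ρ * -1 : ℝ) * u, 0), le_rfl⟩ := by simp [hcdef]
  have hlim : ∀ {l : Filter ℝ} {σ : ℝ}, Tendsto Real.tanh l (𝓝 σ) →
      Tendsto Real.cosh l atTop → Tendsto (fun t => toBar (c₀ t)) l
        (𝓝 (OnePoint.some ⟨(e + (ρ * σ : ℝ) * u, 0), le_rfl⟩)) := by
    intro l σ h1 h2
    refine OnePoint.continuous_coe.continuousAt.tendsto.comp (tendsto_subtype_rng.2 ?_)
    refine Tendsto.prodMk_nhds ?_ (h2.const_div_atTop ρ)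
    have : Continuous fun s : ℝ => e + (ρ * s : ℝ) * u := by fun_prop
    exact (this.tendsto σ).comp h1
  have hcosh : Tendsto Real.cosh atTop atTop := by
    refine tendsto_atTop_mono (f := fun t => Real.exp t / 2) (fun t => ?_)
      (Real.tendsto_exp_atTop.atTop_div_const two_pos)
    rw [Real.cosh_eq]
    have := Real.exp_pos (-t)
    linarith
  have htanh : Tendsto Real.tanh atTop (𝓝 1) := by
    have h : Tendsto (fun t => 1 - Real.exp (-t) / Real.cosh t) atTop (𝓝 (1 - 0)) :=
      tendsto_const_nhds.sub (Real.tendsto_exp_neg_atTop_nhds_zero.div_atTop hcosh)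
    rw [sub_zero] at h
    refine h.congr fun t => ?_
    rw [Real.tanh_eq_sinh_div_cosh, ← Real.cosh_sub_sinh, sub_div,
      div_self (Real.cosh_pos t).ne', sub_sub_cancel]
  refine ⟨c, ⟨continuous_of_real_of_tendsto ?_ ?_ ?_, c₀, h₀, fun s t => ?_⟩, h₀⟩
  · simp only [h₀]
    refine continuous_toBar.comp (continuous_induced_rng.2 ?_)
    have h1 : Continuous Real.tanh := by
      simp only [funext Real.tanh_eq_sinh_div_cosh]
      exact Real.continuous_sinh.div Real.continuous_cosh fun t => (Real.cosh_pos t).ne'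
    have h2 : Continuous fun t : ℝ => ρ / Real.cosh t :=
      continuous_const.div Real.continuous_cosh fun t => (Real.cosh_pos t).ne'
    have h3 : Continuous fun t : ℝ => e + (ρ * Real.tanh t : ℝ) * u := by fun_prop
    exact h3.prodMk h2
  · simp only [h₀, htop]
    exact hlim htanh hcosh
  · simp only [h₀, hbot]
    refine hlim ?_ ?_
    · have := (htanh.comp tendsto_neg_atBot_atTop).neg
      simpa [Function.comp_def, Real.tanh_neg] using this
    · simpa [Function.comp_def, Real.cosh_neg] using hcosh.comp tendsto_neg_atBot_atTop
  · refine hypDist_eq_of_cosh ?_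
    simp only [hc₀]
    rw [add_sub_add_left_eq_sub, ← sub_mul, norm_mul, hu, mul_one, ← Complex.ofReal_sub,
      Complex.norm_real, Real.norm_eq_abs, sq_abs, Real.cosh_sub, Real.tanh_eq_sinh_div_cosh,
      Real.tanh_eq_sinh_div_cosh]
    have h1 := Real.cosh_pos s
    have h2 := Real.cosh_pos t
    have h3 := Real.cosh_sq s
    have h4 := Real.cosh_sq t
    field_simp
    linear_combination -(h3 * Real.cosh t ^ 2) - h4 * Real.cosh s ^ 2

/-- Geodesics on a hemisphere project to straight line segments in `ℂ`. -/
theorem toBar_mem_geodSegment_of_hemisphere {o : ℂ} {r : ℝ} {z w m : H3}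
    (hz : Complex.normSq (z.x - o) + z.y ^ 2 = r) (hw : Complex.normSq (w.x - o) + w.y ^ 2 = r)
    (hm : Complex.normSq (m.x - o) + m.y ^ 2 = r) (h : m.x ∈ segment ℝ z.x w.x) :
    toBar m ∈ geodSegment (toBar z) (toBar w) := by
  obtain ⟨α, β, hα, hβ, hαβ, hmx⟩ := h
  have hzy := z.y_pos
  have hwy := w.y_pos
  have hmy := m.y_pos
  by_cases hne : z.x = w.x
  · have hmz : m.x = z.x := by
      rw [← hmx, ← hne, ← add_smul, hαβ, one_smul]
    have e1 : m = z := H3.ext hmz (by rw [hmz] at hm; nlinarith)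
    have e2 : m = w := H3.ext (hmz.trans hne) (by rw [hmz.trans hne] at hm; nlinarith)
    exact Or.inl ⟨by rw [e1], by rw [e2]⟩
  set v := w.x - z.x with hv
  have hv0 : 0 < ‖v‖ := norm_pos_iff.2 (sub_ne_zero.2 (Ne.symm hne))
  set u : ℂ := v / (‖v‖ : ℝ) with hu
  have hu1 : ‖u‖ = 1 := by
    rw [hu, norm_div, Complex.norm_real, norm_norm, div_self hv0.ne']
  have hun : u.re * u.re + u.im * u.im = 1 := by
    rw [← Complex.normSq_apply, Complex.normSq_eq_norm_sq, hu1, one_pow]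
  have hvu : v = (‖v‖ : ℝ) * u := by
    rw [hu, mul_div_cancel₀]
    exact Complex.ofReal_ne_zero.2 hv0.ne'
  -- the coordinate along `u` of the projection of `z.x`, measured from the foot of the
  -- perpendicular from `o` to the line
  set σ : ℝ := (z.x.re - o.re) * u.re + (z.x.im - o.im) * u.im with hσ
  set e : ℂ := z.x - σ * u with he
  have hsq : ∀ s : ℝ, Complex.normSq (e + s * u - o) = Complex.normSq (e - o) + s ^ 2 := by
    intro s
    simp only [Complex.normSq_apply, he, Complex.sub_re, Complex.sub_im, Complex.add_re,
      Complex.add_im, Complex.re_ofReal_mul, Complex.im_ofReal_mul]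
    rw [hσ]
    linear_combination (s ^ 2 - 2 * s * ((z.x.re - o.re) * u.re + (z.x.im - o.im) * u.im)) * hun
  have hzx : z.x = e + (σ : ℂ) * u := by rw [he]; ring
  have hwx : w.x = e + ((σ + ‖v‖ : ℝ) : ℂ) * u := by
    rw [Complex.ofReal_add, add_mul, ← hvu, ← add_assoc, ← hzx, hv]
    ring
  have hmx' : m.x = e + ((σ + β * ‖v‖ : ℝ) : ℂ) * u := by
    rw [Complex.ofReal_add, add_mul, ← add_assoc, ← hzx, Complex.ofReal_mul, mul_assoc, ← hvu, hv,
      ← hmx, eq_sub_iff_add_eq.2 hαβ, Complex.real_smul, Complex.real_smul, Complex.ofReal_sub,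
      Complex.ofReal_one]
    ring
  set ρ2 : ℝ := r - Complex.normSq (e - o) with hρ2
  have hy : ∀ (p : H3) (s : ℝ), Complex.normSq (p.x - o) + p.y ^ 2 = r →
      p.x = e + (s : ℂ) * u → p.y ^ 2 = ρ2 - s ^ 2 := by
    intro p s hp hps
    rw [hps, hsq] at hp
    linarith
  have hρ2pos : 0 < ρ2 := by
    have := hy z σ hz hzx
    nlinarith [sq_nonneg σ]
  have hρ : 0 < √ρ2 := Real.sqrt_pos.2 hρ2pos
  obtain ⟨c, hc, hcf⟩ := isExtGeodesic_semicircle e u hu1 hρ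
  -- the parameter of the point `p` over `e + s u`
  have hpar : ∀ (p : H3) (s : ℝ), Complex.normSq (p.x - o) + p.y ^ 2 = r →
      p.x = e + (s : ℂ) * u → ∃ t : ℝ, √ρ2 * Real.tanh t = s ∧ c t = toBar p := by
    intro p s hp hps
    have hpy := p.y_pos
    have h1 := hy p s hp hps
    have h2 : Real.cosh (Real.arsinh (s / p.y)) = √ρ2 / p.y := by
      rw [Real.cosh_arsinh, show 1 + (s / p.y) ^ 2 = ρ2 / p.y ^ 2 by field_simp; linarith,
        Real.sqrt_div hρ2pos.le, Real.sqrt_sq hpy.le]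
    have h3 : √ρ2 * Real.tanh (Real.arsinh (s / p.y)) = s := by
      rw [Real.tanh_eq_sinh_div_cosh, h2, Real.sinh_arsinh]
      field_simp
    refine ⟨Real.arsinh (s / p.y), h3, ?_⟩
    rw [hcf]
    refine congrArg toBar (H3.ext ?_ ?_)
    · simp only [h3, hps]
    · simp only [h2]
      field_simp
  have hmono : ∀ {t₁ t₂ : ℝ}, √ρ2 * Real.tanh t₁ ≤ √ρ2 * Real.tanh t₂ → t₁ ≤ t₂ := by
    intro t₁ t₂ h
    have h := Real.artanh_le_artanh (Real.neg_one_lt_tanh t₁) (Real.tanh_lt_one t₂)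
      (le_of_mul_le_mul_left h hρ)
    rwa [Real.artanh_tanh, Real.artanh_tanh] at h
  obtain ⟨t₁, h1, e1⟩ := hpar z _ hz hzx
  obtain ⟨t₂, h2, e2⟩ := hpar m _ hm hmx'
  obtain ⟨t₃, h3, e3⟩ := hpar w _ hw hwx
  refine Or.inr ⟨c, hc, t₁, t₂, t₃, EReal.coe_le_coe_iff.2 (hmono ?_),
    EReal.coe_le_coe_iff.2 (hmono ?_), e1, e2, e3⟩
  · rw [h1, h2]
    nlinarith
  · rw [h2, h3]
    nlinarith

/-! ### The polytope -/

theorem mem_triangle_iff {w : ℂ} : w ∈ triangle ↔ 1 ≤ w.re ∧ 0 ≤ w.im ∧ w.re + w.im ≤ 2 := by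
  constructor
  · have hconv : Convex ℝ {w : ℂ | 1 ≤ w.re ∧ 0 ≤ w.im ∧ w.re + w.im ≤ 2} := by
      intro v hv w hw a b ha hb hab
      simp only [mem_ofPred_eq, Complex.add_re, Complex.add_im, Complex.real_smul,
        Complex.re_ofReal_mul, Complex.im_ofReal_mul] at hv hw ⊢
      obtain ⟨h1, h2, h3⟩ := hv
      obtain ⟨h4, h5, h6⟩ := hw
      obtain rfl : b = 1 - a := by linarith
      refine ⟨by nlinarith, by nlinarith, by nlinarith⟩
    intro h
    refine convexHull_min ?_ hconv h
    rintro v (rfl | rfl | rfl) <;> norm_num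
  · rintro ⟨h1, h2, h3⟩
    have hconv : Convex ℝ triangle := convex_convexHull ℝ _
    have hsub : ({1, 2, 1 + Complex.I} : Set ℂ) ⊆ triangle := subset_convexHull ℝ _
    have e : w = (2 - w.re - w.im) • (1 : ℂ) + (w.re - 1) • (2 : ℂ) + w.im • (1 + Complex.I) := by
      apply Complex.ext <;> simp
      ring
    rw [e]
    have := hconv.sum_mem (t := Finset.univ) (w := ![2 - w.re - w.im, w.re - 1, w.im])
      (z := ![1, 2, 1 + Complex.I]) (by
        intro i _
        fin_cases i <;> simp <;> linarith)
      (by simp [Fin.sum_univ_three]; ring)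
      (by
        intro i _
        fin_cases i <;> simp <;> apply hsub <;> simp)
    simpa [Fin.sum_univ_three, mul_add] using this

/-- The part of `H^3` over the triangle and on or above the hemisphere with centre `1` and
radius `√2`. -/
def floorDomain : Set H3 := {z | z.x ∈ triangle ∧ 2 ≤ Complex.normSq (z.x - 1) + z.y ^ 2}

theorem floorDomain_eq : floorDomain = halfSpace (-1) 1 0 0 ∩ halfSpace 0 0 1 0 ∩
    halfSpace 2 (-1) (-1) 0 ∩ halfSpace (-1) (-2) 0 1 := by
  ext z
  simp only [floorDomain, halfSpace, mem_ofPred_eq, mem_inter_iff, mem_triangle_iff,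
    Complex.normSq_apply, Complex.sub_re, Complex.sub_im, Complex.one_re, Complex.one_im]
  constructor
  · rintro ⟨⟨h1, h2, h3⟩, h4⟩
    refine ⟨⟨⟨?_, ?_⟩, ?_⟩, ?_⟩ <;> nlinarith
  · rintro ⟨⟨⟨h1, h2⟩, h3⟩, h4⟩
    refine ⟨⟨?_, ?_, ?_⟩, ?_⟩ <;> nlinarith

theorem isHypConvex_insert_floorDomain :
    IsHypConvex (insert OnePoint.infty (toBar '' floorDomain)) := by
  rw [floorDomain_eq, image_inter toBar_injective, image_inter toBar_injective,
    image_inter toBar_injective, insert_inter_distrib, insert_inter_distrib, insert_inter_distrib]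
  exact (((isHypConvex_insert_infty_halfSpace _ _ _ le_rfl).inter
    (isHypConvex_insert_infty_halfSpace _ _ _ le_rfl)).inter
    (isHypConvex_insert_infty_halfSpace _ _ _ le_rfl)).inter
    (isHypConvex_insert_infty_halfSpace _ _ _ zero_le_one)

/-- The points of the hemisphere over the triangle are reached by two geodesic segments on the
hemisphere, one from `2 + j` to `1 + i + j` and one from `1 + √2 j`; the points above them lie on
vertical segments to `∞`. -/
theorem toBar_mem_of_isHypConvex {S : Set H3bar} (hS : IsHypConvex S) (hv : range vertices ⊆ S)
    {z : H3} (hz : z ∈ floorDomain) : toBar z ∈ S := by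
  have hv0 : toBar ⟨1, √2, by positivity⟩ ∈ S := hv ⟨0, rfl⟩
  have hv1 : toBar ⟨2, 1, one_pos⟩ ∈ S := hv ⟨1, rfl⟩
  have hv2 : toBar ⟨1 + Complex.I, 1, one_pos⟩ ∈ S := hv ⟨2, rfl⟩
  have hv3 : OnePoint.infty ∈ S := hv ⟨3, rfl⟩
  obtain ⟨hT, hfl⟩ := hz
  obtain ⟨h1, h2, h3⟩ := mem_triangle_iff.1 hT
  -- the point of the hemisphere over `w`
  have hpt : ∀ w : ℂ, Complex.normSq (w - 1) < 2 → ∃ p : H3, p.x = w ∧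
      Complex.normSq (p.x - 1) + p.y ^ 2 = 2 := fun w hw =>
    ⟨⟨w, √(2 - Complex.normSq (w - 1)), Real.sqrt_pos.2 (by linarith)⟩, rfl, by
      simp only
      rw [Real.sq_sqrt (by linarith)]
      ring⟩
  have hle : Complex.normSq (z.x - 1) ≤ 1 := by
    simp only [Complex.normSq_apply, Complex.sub_re, Complex.sub_im, Complex.one_re,
      Complex.one_im]
    nlinarith
  obtain ⟨p, hpx, hp⟩ := hpt z.x (by linarith)
  have hpS : toBar p ∈ S := by
    have hA : Complex.normSq ((1 : ℂ) - 1) + √2 ^ 2 = 2 := by norm_num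
    have hB : Complex.normSq ((2 : ℂ) - 1) + (1 : ℝ) ^ 2 = 2 := by norm_num
    have hC : Complex.normSq ((1 + Complex.I : ℂ) - 1) + (1 : ℝ) ^ 2 = 2 := by norm_num
    by_cases h0 : z.x = 1
    · have : p = ⟨1, √2, by positivity⟩ := by
        refine H3.ext (hpx.trans h0) ?_
        rw [hpx, h0] at hp
        have := p.y_pos
        simp only
        rw [eq_comm, Real.sqrt_eq_iff_mul_self_eq_of_pos this]
        simpa [← pow_two] using hp
      rwa [this]
    -- `z.x = 1 + τ (e - 1)` with `e` on the hypotenuse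
    set τ : ℝ := (z.x.re - 1) + z.x.im with hτ
    have hτ0 : 0 < τ := by
      rcases (show 0 ≤ τ by linarith).eq_or_lt with h | h
      · refine absurd (Complex.ext ?_ ?_) h0
        · simp only [Complex.one_re]
          linarith
        · simp only [Complex.one_im]
          linarith
      · exact h
    set ν : ℝ := z.x.im / τ with hν
    have hν0 : 0 ≤ ν := div_nonneg h2 hτ0.le
    have hν1 : ν ≤ 1 := (div_le_one hτ0).2 (by linarith)
    have hντ : τ * ν = z.x.im := by rw [hν]; field_simp
    obtain ⟨e, hex, he⟩ := hpt ⟨2 - ν, ν⟩ (by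
      simp only [Complex.normSq_apply, Complex.sub_re, Complex.sub_im, Complex.one_re,
        Complex.one_im]
      nlinarith)
    have heS : toBar e ∈ S := by
      refine hS _ hv1 _ hv2 (toBar_mem_geodSegment_of_hemisphere hB hC he ?_)
      refine ⟨1 - ν, ν, by linarith, hν0, by ring, ?_⟩
      rw [hex]
      apply Complex.ext <;> simp
      ring
    refine hS _ hv0 _ heS (toBar_mem_geodSegment_of_hemisphere hA he hp ?_)
    refine ⟨1 - τ, τ, by linarith, hτ0.le, by ring, ?_⟩
    rw [hex, hpx]
    apply Complex.ext
    · simp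
      linarith
    · simpa using hντ
  refine hS _ hpS _ hv3 (toBar_mem_geodSegment_infty hpx.symm ?_)
  rw [hpx] at hp
  have := p.y_pos
  have := z.y_pos
  nlinarith

theorem hypHull_vertices :
    hypHull (range vertices) = insert OnePoint.infty (toBar '' floorDomain) := by
  apply Subset.antisymm
  · refine sInter_subset_of_mem ⟨isHypConvex_insert_floorDomain, ?_⟩
    rintro _ ⟨i, rfl⟩
    fin_cases i
    · exact Or.inr ⟨_, ⟨mem_triangle_iff.2 (by norm_num), by norm_num⟩, rfl⟩
    · exact Or.inr ⟨_, ⟨mem_triangle_iff.2 (by norm_num), by norm_num⟩, rfl⟩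
    · exact Or.inr ⟨_, ⟨mem_triangle_iff.2 (by norm_num), by norm_num⟩, rfl⟩
    · exact Or.inl rfl
  · rintro _ (rfl | ⟨z, hz, rfl⟩)
    · exact subset_hypHull _ ⟨3, rfl⟩
    · exact toBar_mem_of_isHypConvex (isHypConvex_hypHull _) (subset_hypHull _) hz

theorem preimage_hypHull_vertices : toBar ⁻¹' hypHull (range vertices) = floorDomain := by
  ext z
  rw [hypHull_vertices, mem_preimage, infty_toBar_mem_insert]

theorem vertices_not_subset_of_isTGSurface {S : Set H3bar} (hS : IsTGSurface S) :
    ¬ range vertices ⊆ S := by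
  intro h
  rcases hS with ⟨w, θ, rfl⟩ | ⟨w, r, -, rfl⟩
  · have key : ∀ z : H3, toBar z ∈ vertPlane w θ →
        ∃ r : ℝ, z.x = w + r * Complex.exp (θ * Complex.I) := by
      rintro z (h | ⟨p, ⟨r, hr⟩, h⟩)
      · exact absurd h (toBar_ne_infty z)
      · rw [OnePoint.coe_injective h] at hr
        exact ⟨r, hr⟩
    obtain ⟨r₀, h₀⟩ := key ⟨1, √2, by positivity⟩ (h ⟨0, rfl⟩)
    obtain ⟨r₁, h₁⟩ := key ⟨2, 1, one_pos⟩ (h ⟨1, rfl⟩)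
    obtain ⟨r₂, h₂⟩ := key ⟨1 + Complex.I, 1, one_pos⟩ (h ⟨2, rfl⟩)
    simp only at h₀ h₁ h₂
    have e : ((r₁ - r₀ : ℝ) : ℂ) * Complex.I = ((r₂ - r₀ : ℝ) : ℂ) := by
      have e1 : (r₁ - r₀ : ℂ) * Complex.exp (θ * Complex.I) = 1 := by
        linear_combination h₀ - h₁
      have e2 : (r₂ - r₀ : ℂ) * Complex.exp (θ * Complex.I) = Complex.I := by
        linear_combination h₀ - h₂
      push_cast
      linear_combination (r₂ - r₀ : ℂ) * e1 - (r₁ - r₀ : ℂ) * e2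
    have e3 := congrArg Complex.im e
    rw [Complex.im_ofReal_mul, Complex.I_im, mul_one, Complex.ofReal_im] at e3
    rw [show r₁ = r₀ by linarith] at h₁
    have := h₀.trans h₁.symm
    norm_num at this
  · obtain ⟨p, -, hp⟩ := h ⟨3, rfl⟩
    exact OnePoint.coe_ne_infty p hp

theorem isSolidPolytope_vertices : IsSolidPolytope vertices (hypHull (range vertices)) where
  three_lt := by norm_num
  not_surface _ hS := vertices_not_subset_of_isTGSurface hS
  eq := rfl
  vertex i := by
    -- each vertex is separated from the other three by a half-space
    have key : ∀ T : Set H3bar, IsHypConvex T → (∀ k, k ≠ i → vertices k ∈ T) →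
        vertices i ∉ T → vertices i ∉ hypHull (vertices '' {k | k ≠ i}) :=
      fun T hT h hi hmem => hi (hmem T ⟨hT, by rintro _ ⟨k, hk, rfl⟩; exact h k hk⟩)
    fin_cases i
    · refine key _ (isHypConvex_insert_infty_halfSpace (-2) 1 1 le_rfl) (fun k hk => ?_) ?_
      · fin_cases k
        · exact absurd rfl hk
        · exact Or.inr ⟨_, by norm_num [halfSpace], rfl⟩
        · exact Or.inr ⟨_, by norm_num [halfSpace], rfl⟩
        · exact Or.inl rfl
      · exact fun h => absurd (infty_toBar_mem_insert.1 h) (by norm_num [halfSpace])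
    · refine key _ (isHypConvex_insert_infty_halfSpace 1 (-1) 0 le_rfl) (fun k hk => ?_) ?_
      · fin_cases k
        · exact Or.inr ⟨_, by norm_num [halfSpace], rfl⟩
        · exact absurd rfl hk
        · exact Or.inr ⟨_, by norm_num [halfSpace], rfl⟩
        · exact Or.inl rfl
      · exact fun h => absurd (infty_toBar_mem_insert.1 h) (by norm_num [halfSpace])
    · refine key _ (isHypConvex_insert_infty_halfSpace 0 0 (-1) le_rfl) (fun k hk => ?_) ?_
      · fin_cases k
        · exact Or.inr ⟨_, by norm_num [halfSpace], rfl⟩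
        · exact Or.inr ⟨_, by norm_num [halfSpace], rfl⟩
        · exact absurd rfl hk
        · exact Or.inl rfl
      · exact fun h => absurd (infty_toBar_mem_insert.1 h) (by norm_num [halfSpace])
    · refine key _ (isHypConvex_image_halfSpace 1 2 0 (-1)) (fun k hk => ?_) ?_
      · fin_cases k
        · exact ⟨_, by norm_num [halfSpace], rfl⟩
        · exact ⟨_, by norm_num [halfSpace], rfl⟩
        · exact ⟨_, by norm_num [halfSpace], rfl⟩
        · exact absurd rfl hk
      · rintro ⟨z, -, hz⟩
        exact toBar_ne_infty z hz

/-! ### Divisibility by `1 + i` in the Gaussian integers -/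

/-- Reduction of Gaussian integers modulo the prime `1 + i`. -/
def parity : GaussianInt →+* ZMod 2 := Zsqrtd.lift ⟨1, by decide⟩

theorem parity_apply (z : GaussianInt) : parity z = ((z.re + z.im : ℤ) : ZMod 2) := by
  simp [parity, Zsqrtd.lift]

theorem parity_eq_zero_iff {z : GaussianInt} : parity z = 0 ↔ 2 ∣ z.re + z.im := by
  rw [parity_apply, ZMod.intCast_zmod_eq_zero_iff_dvd]
  rfl

theorem parity_eq_one_or (z : GaussianInt) : parity z = 0 ∨ parity z = 1 := by
  generalize parity z = x
  revert x
  decide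

theorem parity_star (z : GaussianInt) : parity (star z) = parity z := by
  rw [parity_apply, parity_apply]
  push_cast [Zsqrtd.re_star, Zsqrtd.im_star]
  rw [ZMod.neg_eq_self_mod_two]

theorem two_dvd_one_add_sq {t : GaussianInt} (ht : parity t = 1) : 2 ∣ 1 + t * t := by
  have h : ¬ 2 ∣ t.re + t.im := by
    rw [← parity_eq_zero_iff, ht]
    decide
  have h1 : 2 ∣ 1 + t.re * t.re - t.im * t.im := by
    have h2 : ¬ 2 ∣ (t.re + t.im) * (t.re - t.im) := by
      rw [Int.prime_two.dvd_mul]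
      omega
    have h3 : 1 + t.re * t.re - t.im * t.im = 1 + (t.re + t.im) * (t.re - t.im) := by ring
    omega
  obtain ⟨k, hk⟩ := h1
  refine ⟨⟨k, t.re * t.im⟩, Zsqrtd.ext ?_ ?_⟩
  · simp
    linarith
  · simp
    ring

theorem mul_star_eq_norm (C : GaussianInt) : C * star C = (C.norm : GaussianInt) :=
  (Zsqrtd.norm_eq_mul_conj C).symm

theorem parity_eq_zero_of_norm_two {C : GaussianInt} (hC : C.norm = 2) : parity C = 0 := by
  have h := congrArg parity (mul_star_eq_norm C)
  rw [map_mul, parity_star, hC, map_intCast] at h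
  rcases parity_eq_one_or C with h1 | h1
  · exact h1
  · rw [h1] at h
    exact absurd h (by decide)

theorem dvd_of_norm_two {C E : GaussianInt} (hC : C.norm = 2) (hE : parity E = 0) : C ∣ E := by
  have h1 := parity_eq_zero_iff.1 (parity_eq_zero_of_norm_two hC)
  rw [parity_eq_zero_iff] at hE
  have h2 : C.re * C.re + C.im * C.im = 2 := by
    have := hC
    rw [Zsqrtd.norm_def] at this
    linarith
  have h3 : C.re ≤ 1 := by nlinarith
  have h4 : -1 ≤ C.re := by nlinarith
  have h5 : C.im ≤ 1 := by nlinarith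
  have h6 : -1 ≤ C.im := by nlinarith
  have h7 : 2 ∣ E.re * C.re + E.im * C.im := by
    interval_cases C.re <;> interval_cases C.im <;> omega
  have h8 : 2 ∣ E.im * C.re - E.re * C.im := by
    interval_cases C.re <;> interval_cases C.im <;> omega
  obtain ⟨x, hx⟩ := h7
  obtain ⟨y, hy⟩ := h8
  refine ⟨⟨x, y⟩, Zsqrtd.ext ?_ ?_⟩
  · have : 2 * E.re = 2 * (C.re * x + -1 * C.im * y) := by
      linear_combination (-E.re) * h2 + C.re * hx - C.im * hy
    simpa using mul_left_cancel₀ two_ne_zero this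
  · have : 2 * E.im = 2 * (C.re * y + C.im * x) := by
      linear_combination (-E.im) * h2 + C.im * hx + C.re * hy
    simpa using mul_left_cancel₀ two_ne_zero this

theorem parity_eq_zero_of_norm_two_of_sq {C D E s : GaussianInt} (hC : C.norm = 2)
    (hE : E * E = C * D) (hs : C + D = 2 * s) : parity s = 0 := by
  have hC0 := parity_eq_zero_of_norm_two hC
  have hCne : C ≠ 0 := by
    rintro rfl
    simp at hC
  have hsne : star C ≠ 0 := star_ne_zero.2 hCne
  have h2 : C * star C = 2 := by rw [mul_star_eq_norm, hC]; rfl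
  have hE0 : parity E = 0 := by
    have h := congrArg parity hE
    rw [map_mul, map_mul, hC0, zero_mul] at h
    exact mul_self_eq_zero.1 h
  obtain ⟨t, rfl⟩ := dvd_of_norm_two hC hE0
  have hD : D = C * (t * t) := mul_left_cancel₀ hCne (by rw [← hE]; ring)
  have h3 : 1 + t * t = star C * s :=
    mul_left_cancel₀ hCne (by rw [← mul_assoc, h2, ← hs, hD]; ring)
  have ht : parity t = 1 := by
    have h := congrArg parity h3
    rw [map_mul, parity_star, hC0, zero_mul, map_add, map_one, map_mul] at h
    rcases parity_eq_one_or t with h1 | h1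
    · rw [h1] at h
      exact absurd h (by decide)
    · exact h1
  obtain ⟨w, hw⟩ := two_dvd_one_add_sq ht
  have hsw : s = C * w := mul_left_cancel₀ hsne (by rw [← h3, hw, ← h2]; ring)
  rw [hsw, map_mul, hC0, zero_mul]

theorem parity_eq_one_of_norm_one_of_sq {C D E s : GaussianInt} (hC : C.norm = 1)
    (hE : E * E = C * D) (hs : C + D = 2 * s) : parity (star C * E) = 1 := by
  have h1 : C * star C = 1 := by rw [mul_star_eq_norm, hC]; rfl
  have h2 : 1 + star C * E * (star C * E) = 2 * (star C * s) := by
    linear_combination (star C * star C) * hE + (star C) * hs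
      + (star C * D - 1) * h1
  have h := congrArg parity h2
  rw [map_mul, map_add, map_one, map_mul _ (star C * E), map_ofNat,
    show (OfNat.ofNat 2 : ZMod 2) = 0 from rfl, zero_mul] at h
  rcases parity_eq_one_or (star C * E) with h3 | h3
  · rw [h3] at h
    exact absurd h (by decide)
  · exact h3

/-! ### The group `Γ` -/

/-- The Gaussian integers as a subring of `ℂ`. -/
def gaussianSubring : Subring ℂ := GaussianInt.toComplex.range

theorem I_mem_gaussianSubring : Complex.I ∈ gaussianSubring :=
  ⟨⟨0, 1⟩, by simp [GaussianInt.toComplex_def]⟩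

theorem conj_inv (g : SL2C) : conj g⁻¹ = (conj g)ᵀ := by
  ext i j
  simp only [conj, halfTrace, Matrix.of_apply, Matrix.transpose_apply, inv_inv]
  congr 1
  calc (slBasis i * ((g⁻¹).1 * slBasis j * g.1)).trace
      = (slBasis i * (g⁻¹).1 * (slBasis j * g.1)).trace := by simp only [Matrix.mul_assoc]
    _ = (slBasis j * g.1 * (slBasis i * (g⁻¹).1)).trace := Matrix.trace_mul_comm _ _
    _ = (slBasis j * (g.1 * slBasis i * (g⁻¹).1)).trace := by simp only [Matrix.mul_assoc]

theorem conj_mul_transpose (g : SL2C) : conj g * (conj g)ᵀ = 1 := by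
  rw [← conj_inv, ← conj_mul, mul_inv_cancel, conj_one]

theorem det_conj (g : SL2C) : (conj g).det = 1 := by
  obtain ⟨a, b, c, d, hg⟩ : ∃ a b c d : ℂ, g.1 = !![a, b; c, d] :=
    ⟨_, _, _, _, Matrix.eta_fin_two g.1⟩
  have hdet := g.2
  rw [hg, Matrix.det_fin_two_of] at hdet
  have hI := Complex.I_sq
  rw [conj_eq g hg, Matrix.det_fin_three]
  simp only [Matrix.of_apply, Matrix.cons_val', Matrix.cons_val_zero, Matrix.cons_val_one,
    Matrix.cons_val]
  ring_nf
  simp only [hI]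
  linear_combination ((a * d - b * c) ^ 2 + (a * d - b * c) + 1) * hdet

theorem mem_Gam_iff {g : SL2C} : g ∈ Gam ↔ ∀ i j, conj g i j ∈ gaussianSubring := by
  constructor
  · rintro ⟨A, -, hA⟩ i j
    rw [hA]
    exact ⟨A i j, rfl⟩
  · intro h
    choose A hA using h
    have hA' : conj g = (Matrix.of A).map GaussianInt.toComplex := by
      ext i j
      exact (hA i j).symm
    have hinj : Function.Injective GaussianInt.toComplex := fun x y h =>
      GaussianInt.toComplex_inj.1 h
    refine ⟨Matrix.of A, ?_, hA'⟩
    rw [Matrix.mem_specialOrthogonalGroup_iff, Matrix.mem_orthogonalGroup_iff]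
    constructor
    · apply Matrix.map_injective hinj
      have h1 := conj_mul_transpose g
      rw [hA'] at h1
      change Matrix.map _ _ = Matrix.map _ _
      rw [Matrix.map_mul, Matrix.map_one _ (map_zero _) (map_one _), ← h1]
      rfl
    · apply hinj
      have h1 := det_conj g
      rw [hA'] at h1
      rw [map_one, ← h1]
      exact RingHom.map_det _ _

/-- The matrix entries of `conj g`, up to units of `ℤ[i]`, in terms of those of `g`. -/
theorem mem_Gam_iff_entries {g : SL2C} {a b c d : ℂ} (hg : g.1 = !![a, b; c, d]) :
    g ∈ Gam ↔ ((a ^ 2 - c ^ 2 + d ^ 2 - b ^ 2) / 2 ∈ gaussianSubring ∧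
      (a ^ 2 - c ^ 2 + b ^ 2 - d ^ 2) / 2 ∈ gaussianSubring ∧
      (b ^ 2 + d ^ 2 - a ^ 2 - c ^ 2) / 2 ∈ gaussianSubring ∧
      (a ^ 2 + c ^ 2 + b ^ 2 + d ^ 2) / 2 ∈ gaussianSubring) ∧
      c * d - a * b ∈ gaussianSubring ∧ a * b + c * d ∈ gaussianSubring ∧
      -(a * c) + b * d ∈ gaussianSubring ∧ a * c + b * d ∈ gaussianSubring ∧
      a * d + b * c ∈ gaussianSubring := by
  have hI : ∀ x : ℂ, Complex.I * x ∈ gaussianSubring ↔ x ∈ gaussianSubring := fun x =>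
    ⟨fun h => by
      have := gaussianSubring.mul_mem (gaussianSubring.neg_mem I_mem_gaussianSubring) h
      rwa [← mul_assoc, neg_mul, Complex.I_mul_I, neg_neg, one_mul] at this,
      gaussianSubring.mul_mem I_mem_gaussianSubring⟩
  rw [mem_Gam_iff, conj_eq g hg]
  simp only [Fin.forall_fin_succ, Matrix.of_apply, Matrix.cons_val', Matrix.cons_val_zero,
    Matrix.cons_val_succ, IsEmpty.forall_iff, and_true, mul_div_assoc, neg_mul, neg_mem_iff, hI]
  tauto

/-- The Gaussian integers attached to the bottom row `(c, d)` of an element of `Γ`, with the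
relation `C γ = p s - (1 + H)` coming from `ad - bc = 1`. Here `s = c² + d²`, `H = 2 b c`, `B = 2 b²`,
`p = a² + c²` and `γ = (a² + b² + c² + d²) / 2`. -/
theorem exists_gaussianInt_of_mem_Gam {g : SL2C} (hg : g ∈ Gam) :
    ∃ C D E s H B : GaussianInt, (C : ℂ) = 2 * g.1 1 0 ^ 2 ∧ (D : ℂ) = 2 * g.1 1 1 ^ 2 ∧
      (E : ℂ) = 2 * (g.1 1 0 * g.1 1 1) ∧ E * E = C * D ∧ C + D = 2 * s ∧ H * H = B * C ∧
      ∃ p γ : GaussianInt, C * γ = p * s - (1 + H) := by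
  obtain ⟨a, b, c, d, h⟩ : ∃ a b c d : ℂ, g.1 = !![a, b; c, d] :=
    ⟨_, _, _, _, Matrix.eta_fin_two g.1⟩
  obtain ⟨⟨h1, h2, h3, h4⟩, h5, h6, h7, h8, h9⟩ := (mem_Gam_iff_entries h).1 hg
  have hdet := g.2
  rw [h, Matrix.det_fin_two_of] at hdet
  simp only [h, Matrix.of_apply, Matrix.cons_val', Matrix.cons_val_zero, Matrix.cons_val_one,
    Matrix.cons_val_fin_one]
  have hx : ∀ {x : ℂ}, x ∈ gaussianSubring → ∃ X : GaussianInt, (X : ℂ) = x := fun h => h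
  obtain ⟨α, hα⟩ := hx h1
  obtain ⟨β, hβ⟩ := hx h2
  obtain ⟨δ, hδ⟩ := hx h3
  obtain ⟨γ, hγ⟩ := hx h4
  obtain ⟨e₁, he₁⟩ := hx h5
  obtain ⟨e₂, he₂⟩ := hx h6
  obtain ⟨n, hn⟩ := hx h9
  have hC : ((γ - δ - α - β : GaussianInt) : ℂ) = 2 * c ^ 2 := by
    simp only [map_sub, hα, hβ, hγ, hδ]
    ring
  have hD : ((α - β + γ + δ : GaussianInt) : ℂ) = 2 * d ^ 2 := by
    simp only [map_add, map_sub, hα, hβ, hγ, hδ]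
    ring
  have hE : ((e₁ + e₂ : GaussianInt) : ℂ) = 2 * (c * d) := by
    simp only [map_add, he₁, he₂]
    ring
  have hB : ((γ + δ - α + β : GaussianInt) : ℂ) = 2 * b ^ 2 := by
    simp only [map_add, map_sub, hα, hβ, hγ, hδ]
    ring
  have hs : ((γ - β : GaussianInt) : ℂ) = c ^ 2 + d ^ 2 := by
    simp only [map_sub, hγ, hβ]
    ring
  have hp : ((γ - δ : GaussianInt) : ℂ) = a ^ 2 + c ^ 2 := by
    simp only [map_sub, hγ, hδ]
    ring
  have hH : ((n - 1 : GaussianInt) : ℂ) = 2 * (b * c) := by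
    simp only [map_sub, map_one, hn]
    linear_combination hdet
  refine ⟨γ - δ - α - β, α - β + γ + δ, e₁ + e₂, γ - β, n - 1, γ + δ - α + β, hC, hD, hE, ?_, ?_,
    ?_, γ - δ, γ, ?_⟩
  · apply GaussianInt.toComplex_inj.1
    rw [GaussianInt.toComplex_mul, GaussianInt.toComplex_mul, hC, hD, hE]
    ring
  · ring
  · apply GaussianInt.toComplex_inj.1
    rw [GaussianInt.toComplex_mul, GaussianInt.toComplex_mul, hC, hB, hH]
    ring
  · apply GaussianInt.toComplex_inj.1
    rw [GaussianInt.toComplex_sub, GaussianInt.toComplex_add, GaussianInt.toComplex_mul,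
      GaussianInt.toComplex_mul, hC, hs, hp, hH, hγ, GaussianInt.toComplex_one]
    linear_combination -(a * d + b * c + 1) * hdet

theorem normSq_sq_of_coe_eq {C : GaussianInt} {c : ℂ} (h : (C : ℂ) = 2 * c ^ 2) :
    (C.norm : ℝ) = 4 * Complex.normSq c ^ 2 := by
  rw [GaussianInt.intCast_real_norm, h, map_mul, map_pow]
  norm_num

/-- The lower left entry of an element of `Γ` is `0`, or `2 |c|² = 1`, or `|c| ≥ 1`; the centres
`-d/c` of the hemispheres of the second kind lie in the coset `1 + (1 + i) ℤ[i]`. -/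
theorem row_of_mem_Gam {g : SL2C} (hg : g ∈ Gam) (hc : g.1 1 0 ≠ 0) :
    1 ≤ Complex.normSq (g.1 1 0) ∨ Complex.normSq (g.1 1 0) = 1 / 2 ∧
      ∃ t : GaussianInt, parity t = 1 ∧ g.1 1 1 = g.1 1 0 * t := by
  obtain ⟨C, D, E, s, H, B, hC, hD, hE, hEE, hs, hHH, p, γ, hr⟩ := exists_gaussianInt_of_mem_Gam hg
  have hN := normSq_sq_of_coe_eq hC
  have hpos := Complex.normSq_pos.2 hc
  rw [or_iff_not_imp_left, not_le]
  intro hlt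
  have h4 : C.norm < 4 := by
    have : (C.norm : ℝ) < 4 := by rw [hN]; nlinarith
    exact_mod_cast this
  have h0 : 0 < C.norm := by
    have : (0 : ℝ) < C.norm := by rw [hN]; positivity
    exact_mod_cast this
  have h3 : C.norm ≠ 3 := by
    intro h
    rw [Zsqrtd.norm_def] at h
    have h5 : C.re * C.re + C.im * C.im = 3 := by linarith
    have h6 : C.re ≤ 1 := by nlinarith
    have h7 : -1 ≤ C.re := by nlinarith
    have h8 : C.im ≤ 1 := by nlinarith
    have h9 : -1 ≤ C.im := by nlinarith
    interval_cases C.re <;> interval_cases C.im <;> omega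
  have h12 : C.norm = 1 ∨ C.norm = 2 := by omega
  rcases h12 with h1 | h2
  · refine ⟨?_, star C * E, parity_eq_one_of_norm_one_of_sq h1 hEE hs, ?_⟩
    · rw [h1] at hN
      push_cast at hN
      nlinarith
    · have h5 : C * star C = 1 := by rw [mul_star_eq_norm, h1]; rfl
      have h6 := congrArg GaussianInt.toComplex h5
      rw [GaussianInt.toComplex_mul, hC, GaussianInt.toComplex_one] at h6
      rw [GaussianInt.toComplex_mul, hE]
      linear_combination (-g.1 1 1) * h6
  · exfalso
    have hC0 := parity_eq_zero_of_norm_two h2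
    have hs0 := parity_eq_zero_of_norm_two_of_sq h2 hEE hs
    have hH0 : parity H = 0 := by
      have h := congrArg parity hHH
      rw [map_mul, map_mul, hC0, mul_zero] at h
      exact mul_self_eq_zero.1 h
    have h := congrArg parity hr
    rw [map_mul, map_sub, map_mul, map_add, map_one, hC0, hs0, hH0] at h
    exact absurd h (by simp)

theorem eq_unit_of_norm_one {u : GaussianInt} (hu : u.norm = 1) :
    u = 1 ∨ u = -1 ∨ u = ⟨0, 1⟩ ∨ u = ⟨0, -1⟩ := by
  rw [Zsqrtd.norm_def] at hu
  have h5 : u.re * u.re + u.im * u.im = 1 := by linarith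
  have h6 : u.re ≤ 1 := by nlinarith
  have h7 : -1 ≤ u.re := by nlinarith
  have h8 : u.im ≤ 1 := by nlinarith
  have h9 : -1 ≤ u.im := by nlinarith
  simp only [Zsqrtd.ext_iff]
  simp
  interval_cases hr : u.re <;> interval_cases hi : u.im <;> omega

/-- The upper triangular elements of `Γ` act on `ℂ` by `x ↦ u x + m` with `u` a power of `i` and
`m` divisible by `1 + i`. -/
theorem upper_of_mem_Gam {g : SL2C} (hg : g ∈ Gam) (hc : g.1 1 0 = 0) :
    ∃ u m : GaussianInt, (u = 1 ∨ u = -1 ∨ u = ⟨0, 1⟩ ∨ u = ⟨0, -1⟩) ∧ parity m = 0 ∧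
      g.1 0 0 ^ 2 = u ∧ g.1 0 0 * g.1 0 1 = m ∧ g.1 0 0 * g.1 1 1 = 1 ∧
      Complex.normSq (g.1 1 1) = 1 := by
  obtain ⟨a, b, c, d, h⟩ : ∃ a b c d : ℂ, g.1 = !![a, b; c, d] :=
    ⟨_, _, _, _, Matrix.eta_fin_two g.1⟩
  obtain ⟨⟨h1, h2, h3, h4⟩, h5, h6, -, -, -⟩ := (mem_Gam_iff_entries h).1 hg
  have hdet := g.2
  rw [h, Matrix.det_fin_two_of] at hdet
  simp only [h, Matrix.of_apply, Matrix.cons_val', Matrix.cons_val_zero, Matrix.cons_val_one,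
    Matrix.cons_val_fin_one] at hc ⊢
  subst hc
  have had : a * d = 1 := by linear_combination hdet
  have hx : ∀ {x : ℂ}, x ∈ gaussianSubring → ∃ X : GaussianInt, (X : ℂ) = x := fun h => h
  obtain ⟨α, hα⟩ := hx h1
  obtain ⟨β, hβ⟩ := hx h2
  obtain ⟨γ, hγ⟩ := hx h4
  obtain ⟨m, hm⟩ := hx h6
  have hu : ((α + β : GaussianInt) : ℂ) = a ^ 2 := by
    simp only [map_add, hα, hβ]
    ring
  have hv : ((γ - β : GaussianInt) : ℂ) = d ^ 2 := by
    simp only [map_sub, hγ, hβ]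
    ring
  have hw : ((γ - α : GaussianInt) : ℂ) = b ^ 2 := by
    simp only [map_sub, hγ, hα]
    ring
  have huv : (α + β) * (γ - β) = 1 := by
    apply GaussianInt.toComplex_inj.1
    rw [GaussianInt.toComplex_mul, hu, hv, GaussianInt.toComplex_one]
    linear_combination (a * d + 1) * had
  have hnorm : (α + β).norm = 1 := by
    rw [← Int.natAbs_of_nonneg (GaussianInt.norm_nonneg _),
      Zsqrtd.norm_eq_one_iff.2 (IsUnit.of_mul_eq_one _ huv)]
    rfl
  have hua := eq_unit_of_norm_one hnorm
  refine ⟨α + β, m, hua, ?_, hu.symm, ?_, had, ?_⟩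
  · have hmm : m * m = (α + β) * (γ - α) := by
      apply GaussianInt.toComplex_inj.1
      rw [GaussianInt.toComplex_mul, GaussianInt.toComplex_mul, hu, hw, hm]
      ring
    -- `u + u⁻¹` is even, hence so is `b² = 2 γ - u - u⁻¹`
    have hpar : ∃ k, γ - α = 2 * k := by
      have hk : ∃ k, (α + β) + (γ - β) = 2 * k := by
        have h1 : (α + β) * star (α + β) = 1 := by rw [mul_star_eq_norm, hnorm]; rfl
        have h2 : γ - β = star (α + β) := by
          linear_combination (β - γ) * h1 + star (α + β) * huv
        refine ⟨((α + β).re : ℤ), ?_⟩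
        rw [h2]
        generalize α + β = u
        refine Zsqrtd.ext ?_ ?_
        · simp
          ring
        · simp
      obtain ⟨k, hk⟩ := hk
      exact ⟨k - α, by linear_combination hk⟩
    obtain ⟨k, hk⟩ := hpar
    have h := congrArg parity hmm
    rw [hk, map_mul, map_mul, map_mul, map_ofNat, show (OfNat.ofNat 2 : ZMod 2) = 0 from rfl,
      zero_mul, mul_zero] at h
    exact mul_self_eq_zero.1 h
  · rw [hm]
    ring
  · have h7 : Complex.normSq a ^ 2 = 1 := by
      rw [← map_pow, ← hu, ← GaussianInt.intCast_real_norm, hnorm]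
      norm_num
    have h8 : Complex.normSq a = 1 := by
      have := Complex.normSq_nonneg a
      nlinarith
    have h9 := congrArg Complex.normSq had
    rwa [map_mul, h8, one_mul, map_one] at h9

/-! ### The action in coordinates -/

theorem phi_zero (z : H3) : phi z 0 = -Real.log z.y := rfl

theorem phi_one (z : H3) : phi z 1 = z.x.re := rfl

theorem phi_two (z : H3) : phi z 2 = z.x.im := rfl

theorem phi23_eq (z : H3) : phi23 z = z.x := rfl

theorem sigma23_x (w : ℂ) : (sigma23 w).x = w := rfl

theorem phi_zero_le_iff {z w : H3} : phi z 0 ≤ phi w 0 ↔ w.y ≤ z.y := by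
  rw [phi_zero, phi_zero, neg_le_neg_iff, Real.log_le_log_iff w.y_pos z.y_pos]

theorem phi_zero_eq_iff {z w : H3} : phi z 0 = phi w 0 ↔ z.y = w.y := by
  simp only [le_antisymm_iff, phi_zero_le_iff, and_comm]

theorem coe_smul_y (γ : Gam) (z : H3) :
    (γ • z).y = z.y / denomSq (γ.1.1 1 0) (γ.1.1 1 1) z := rfl

theorem coe_denomSq_pos (γ : Gam) (z : H3) : 0 < denomSq (γ.1.1 1 0) (γ.1.1 1 1) z :=
  denomSq_pos (bottom_row_ne_zero γ.1) z

theorem phi_le_phi_smul_iff {γ : Gam} {z : H3} :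
    phi z 0 ≤ phi (γ • z) 0 ↔ 1 ≤ denomSq (γ.1.1 1 0) (γ.1.1 1 1) z := by
  rw [phi_zero_le_iff, coe_smul_y, div_le_iff₀ (coe_denomSq_pos γ z), le_mul_iff_one_le_right z.y_pos]

theorem phi_smul_eq_phi_iff {γ : Gam} {z : H3} :
    phi (γ • z) 0 = phi z 0 ↔ denomSq (γ.1.1 1 0) (γ.1.1 1 1) z = 1 := by
  rw [phi_zero_eq_iff, coe_smul_y, div_eq_iff (coe_denomSq_pos γ z).ne', eq_comm,
    mul_eq_left₀ z.y_pos.ne']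

/-- The action on `H^3` of the elements of `Γ` fixing `∞`. -/
theorem smul_of_lower_left_eq_zero {γ : Gam} (hc : γ.1.1 1 0 = 0) :
    ∃ u m : GaussianInt, (u = 1 ∨ u = -1 ∨ u = ⟨0, 1⟩ ∨ u = ⟨0, -1⟩) ∧ parity m = 0 ∧
      ∀ z : H3, (γ • z).x = u * z.x + m ∧ (γ • z).y = z.y := by
  obtain ⟨u, m, hu, hm, hau, hab, had, hd⟩ := upper_of_mem_Gam γ.2 hc
  have hden : ∀ z, denomSq (γ.1.1 1 0) (γ.1.1 1 1) z = 1 := fun z => by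
    rw [denomSq, hc, zero_mul, zero_add, map_zero, zero_mul, add_zero, hd]
  refine ⟨u, m, hu, hm, fun z => ⟨?_, ?_⟩⟩
  · have hstar : star (γ.1.1 1 1) = γ.1.1 0 0 := by
      have h1 : γ.1.1 1 1 * star (γ.1.1 1 1) = 1 := by
        rw [RCLike.star_def, Complex.mul_conj, hd, Complex.ofReal_one]
      linear_combination γ.1.1 0 0 * h1 - star (γ.1.1 1 1) * had
    change (γ.1 • z).x = _
    rw [smul_x, hden, hc, zero_mul, zero_add, hstar, star_zero, Complex.ofReal_one, div_one,
      ← hau, ← hab]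
    ring
  · rw [coe_smul_y, hden, div_one]

theorem mem_stab_one_iff {γ : Gam} : γ ∈ stab Gam 1 ↔ γ.1.1 1 0 = 0 := by
  constructor
  · intro h
    have h1 : ∀ z : H3, denomSq (γ.1.1 1 0) (γ.1.1 1 1) z = 1 := fun z =>
      phi_smul_eq_phi_iff.1 (h z 0 zero_lt_one)
    have h2 := h1 ⟨0, 1, one_pos⟩
    have h3 := h1 ⟨0, 2, two_pos⟩
    simp only [denomSq, mul_zero, zero_add] at h2 h3
    exact Complex.normSq_eq_zero.1 (by linarith)
  · intro hc z i hi
    obtain rfl : i = 0 := Fin.ext (by simpa using hi)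
    obtain ⟨u, m, -, -, h⟩ := smul_of_lower_left_eq_zero hc
    exact phi_zero_eq_iff.2 (h z).2

theorem mem_stab_three_iff {γ : Gam} : γ ∈ stab Gam 3 ↔ ∀ z : H3, γ • z = z := by
  constructor
  · intro h z
    rw [← phiInv_phi (γ • z), ← phiInv_phi z]
    congr 1
    ext i
    rw [phiInv_phi]
    exact h z i i.isLt
  · intro h z i _
    rw [h]

theorem mem_F1_iff {z : H3} :
    z ∈ F1 Gam ↔ ∀ γ : Gam, 1 ≤ denomSq (γ.1.1 1 0) (γ.1.1 1 1) z :=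
  forall_congr' fun _ => phi_le_phi_smul_iff

/-! ### The axioms -/

theorem axiomA1_Gam : AxiomA1 Gam := by
  intro j hj γ hγ p q hpq
  have hγ1 : γ ∈ stab Gam 1 := fun z i hi => hγ z i (by
    have : j.val ≠ 0 := fun h => hj (Fin.ext h)
    omega)
  obtain ⟨u, m, -, -, h⟩ := smul_of_lower_left_eq_zero (mem_stab_one_iff.1 hγ1)
  fin_cases j
  · exact absurd rfl hj
  · have h1 := hpq 1 (by simp)
    have h2 := hpq 2 (by simp)
    rw [phi_one, phi_one] at h1
    rw [phi_two, phi_two] at h2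
    change ((γ • p).x).re = ((γ • q).x).re
    rw [(h p).1, (h q).1, Complex.ext h1 h2]
  · have h2 := hpq 2 (by simp)
    rw [phi_two, phi_two] at h2
    have h3 : ∀ w : ℂ, ((u : ℂ) * w + m).re = w.re := fun w => by
      have h4 := hγ ⟨w, 1, one_pos⟩ 1 (by simp)
      rwa [phi_one, (h _).1, phi_one] at h4
    -- the real part is preserved only if the multiplier is `1`
    have h5 := h3 0
    have h6 := h3 1
    have h7 := h3 Complex.I
    simp only [mul_zero, zero_add, mul_one, Complex.add_re, Complex.one_re, Complex.zero_re,
      Complex.mul_re, Complex.I_re, Complex.I_im] at h5 h6 h7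
    change ((γ • p).x).im = ((γ • q).x).im
    rw [(h p).1, (h q).1, Complex.add_im, Complex.add_im, Complex.mul_im, Complex.mul_im, h2,
      show (u : ℂ).im = 0 by linarith]
    ring

theorem diffFun_eq (γ : Gam) (t : EuclideanSpace ℝ (Fin 3)) :
    diffFun γ t = -Real.log (denomSq (γ.1.1 1 0) (γ.1.1 1 1) (phiInv t)) := by
  rw [diffFun, phi_zero, phi_zero, coe_smul_y,
    Real.log_div (phiInv t).y_pos.ne' (coe_denomSq_pos γ _).ne']
  ring

theorem differentiable_diffFun (γ : Gam) : Differentiable ℝ (diffFun γ) := by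
  have h : diffFun γ = fun t => -Real.log (denomSq (γ.1.1 1 0) (γ.1.1 1 1) (phiInv t)) :=
    funext (diffFun_eq γ)
  rw [h]
  refine (Differentiable.log ?_ fun t => (coe_denomSq_pos γ _).ne').neg
  simp only [denomSq, phiInv, Complex.normSq_apply, Complex.add_re, Complex.add_im, Complex.mul_re,
    Complex.mul_im]
  fun_prop

/-- In the direction of growing `y` the derivative of `Δ_{1,γ} = -log (|c x + d|² + |c|² y²)` is
negative unless `c = 0`. -/
theorem lineDeriv_diffFun_neg {γ : Gam} (hγ : γ ∉ stab Gam 1) (t : EuclideanSpace ℝ (Fin 3)) :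
    lineDeriv ℝ (diffFun γ) t (EuclideanSpace.single 0 (-1)) < 0 := by
  have hc := Complex.normSq_pos.2 (mt mem_stab_one_iff.2 hγ)
  set A := Complex.normSq (γ.1.1 1 0 * (phiInv t).x + γ.1.1 1 1) with hA
  set B := Complex.normSq (γ.1.1 1 0) * (phiInv t).y ^ 2 with hB
  have hA0 : 0 ≤ A := Complex.normSq_nonneg _
  have hB0 : 0 < B := mul_pos hc (pow_pos (phiInv t).y_pos 2)
  have h1 : ∀ s : ℝ, diffFun γ (t + s • EuclideanSpace.single 0 (-1)) =
      -Real.log (A + B * Real.exp (2 * s)) := by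
    intro s
    have hx : (phiInv (t + s • EuclideanSpace.single 0 (-1))).x = (phiInv t).x := by
      apply Complex.ext <;> simp [phiInv]
    have hy : (phiInv (t + s • EuclideanSpace.single 0 (-1))).y
        = (phiInv t).y * Real.exp s := by
      simp only [phiInv, ← Real.exp_add]
      congr 1
      simp
      ring
    rw [diffFun_eq, denomSq, hx, hy, ← hA, mul_pow, ← mul_assoc, ← hB, ← Real.exp_nat_mul]
    norm_num
  have h2 : HasDerivAt (fun s : ℝ => -Real.log (A + B * Real.exp (2 * s)))
      (-(B * (Real.exp (2 * 0) * (2 * 1)) / (A + B * Real.exp (2 * 0)))) 0 := by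
    refine HasDerivAt.neg (HasDerivAt.log ?_ (by positivity))
    exact ((((hasDerivAt_id (0 : ℝ)).const_mul 2).exp).const_mul B).const_add A
  rw [lineDeriv, funext h1, h2.deriv]
  simp only [mul_zero, Real.exp_zero, mul_one, one_mul]
  have : 0 < B * 2 / (A + B) := by positivity
  linarith

theorem axiomA2_Gam : AxiomA2 Gam := by
  rintro γ hγ t ⟨-, h⟩
  have h1 := lineDeriv_diffFun_neg hγ t
  rw [(differentiable_diffFun γ t).lineDeriv_eq_fderiv, h] at h1
  exact lt_irrefl _ h1

theorem axiomA4_Gam : AxiomA4 Gam := fun z =>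
  ⟨EuclideanSpace.single 0 (-1), by simp, fun _ hγ => lineDeriv_diffFun_neg hγ _⟩

theorem finite_gaussianInt_norm_le (R : ℝ) : {z : GaussianInt | (z.norm : ℝ) ≤ R}.Finite := by
  obtain ⟨n, hn⟩ := exists_nat_ge R
  refine ((finite_Icc (-(n : ℤ)) n).prod (finite_Icc (-(n : ℤ)) n)).preimage
    (f := fun z : GaussianInt => (z.re, z.im)) (fun z _ w _ h => ?_) |>.subset fun z hz => ?_
  · exact Zsqrtd.ext (congrArg Prod.fst h) (congrArg Prod.snd h)
  · have h1 : z.norm ≤ n := by exact_mod_cast (show (z.norm : ℝ) ≤ R from hz).trans hn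
    rw [Zsqrtd.norm_def] at h1
    have h2 : ∀ x : ℤ, x * x ≤ n → -(n : ℤ) ≤ x ∧ x ≤ n := fun x hx => by
      constructor <;> nlinarith [sq_nonneg (x - 1), sq_nonneg (x + 1)]
    exact ⟨h2 _ (by nlinarith [mul_self_nonneg z.im]), h2 _ (by nlinarith [mul_self_nonneg z.re])⟩

theorem finite_two_mul_sq (R : ℝ) :
    {c : ℂ | (∃ C : GaussianInt, (C : ℂ) = 2 * c ^ 2) ∧ Complex.normSq c ≤ R}.Finite := by
  have h1 := (finite_gaussianInt_norm_le (4 * R ^ 2)).image GaussianInt.toComplex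
  refine (h1.preimage' (f := fun c : ℂ => 2 * c ^ 2) fun b _ => ?_).subset ?_
  · by_cases h : ∃ c₀ : ℂ, 2 * c₀ ^ 2 = b
    · obtain ⟨c₀, rfl⟩ := h
      refine (Set.toFinite {c₀, -c₀}).subset fun c hc => ?_
      have hc' : 2 * c ^ 2 = 2 * c₀ ^ 2 := hc
      exact sq_eq_sq_iff_eq_or_eq_neg.1 (mul_left_cancel₀ two_ne_zero hc')
    · exact Set.finite_empty.subset fun c hc => absurd ⟨c, hc⟩ h
  · rintro c ⟨⟨C, hC⟩, hc⟩
    refine ⟨C, ?_, hC⟩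
    have := Complex.normSq_nonneg c
    rw [mem_ofPred_eq, normSq_sq_of_coe_eq hC]
    nlinarith

/-- The bottom row `(c, d)` of an element of `Γ`; it determines the coset `Γ^{φ₁} γ`. -/
def bottomRow (γ : Gam) : ℂ × ℂ := (γ.1.1 1 0, γ.1.1 1 1)

theorem finite_bottomRow (R : ℝ) : {p : ℂ × ℂ | (∃ γ : Gam, bottomRow γ = p) ∧
    Complex.normSq p.1 ≤ R ∧ Complex.normSq p.2 ≤ R}.Finite := by
  refine ((finite_two_mul_sq R).prod (finite_two_mul_sq R)).subset ?_
  rintro _ ⟨⟨γ, rfl⟩, h1, h2⟩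
  obtain ⟨C, D, -, -, -, -, hC, hD, -⟩ := exists_gaussianInt_of_mem_Gam γ.2
  exact ⟨⟨⟨C, hC⟩, h1⟩, ⟨⟨D, hD⟩, h2⟩⟩

/-- Only finitely many bottom rows `(c, d)` make `|c x + d|² + |c|² y²` small for some point
`x + y j` of a bounded set away from `y = 0`. -/
theorem finite_bottomRow_denomSq_le (K M : ℝ) {η : ℝ} (hη : 0 < η) :
    {p : ℂ × ℂ | (∃ γ : Gam, bottomRow γ = p) ∧ ∃ w : H3, η ≤ w.y ∧ Complex.normSq w.x ≤ M ∧
      denomSq p.1 p.2 w ≤ K}.Finite := by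
  refine (finite_bottomRow (max (K / η ^ 2) (2 * K + 2 * (K / η ^ 2 * M)))).subset ?_
  rintro ⟨c, d⟩ ⟨hγ, w, hy, hx, hw⟩
  simp only [denomSq] at hw
  have h1 := Complex.normSq_nonneg c
  have h2 := Complex.normSq_nonneg (c * w.x + d)
  have h3 : Complex.normSq c ≤ K / η ^ 2 := by
    rw [le_div_iff₀ (pow_pos hη 2)]
    have : η ^ 2 ≤ w.y ^ 2 := by gcongr
    nlinarith
  refine ⟨hγ, h3.trans (le_max_left _ _), le_trans ?_ (le_max_right _ _)⟩
  have h4 : Complex.normSq d + Complex.normSq (c * w.x + d + c * w.x) =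
      2 * Complex.normSq (c * w.x + d) + 2 * Complex.normSq (c * w.x) := by
    simp only [Complex.normSq_apply, Complex.add_re, Complex.add_im]
    ring
  have h5 := Complex.normSq_nonneg (c * w.x + d + c * w.x)
  have h6 : Complex.normSq (c * w.x) ≤ K / η ^ 2 * M := by
    rw [map_mul]
    exact mul_le_mul h3 hx (Complex.normSq_nonneg _) (h1.trans h3)
  have h7 : 0 ≤ Complex.normSq c * w.y ^ 2 := by positivity
  simp only
  linarith

theorem mul_inv_mem_stab_one_of_bottomRow_eq {g h : Gam} (e : bottomRow g = bottomRow h) :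
    g * h⁻¹ ∈ stab Gam 1 := by
  rw [mem_stab_one_iff]
  have h1 : g.1.1 1 0 = h.1.1 1 0 := congrArg Prod.fst e
  have h2 : g.1.1 1 1 = h.1.1 1 1 := congrArg Prod.snd e
  change (g.1 * (h.1)⁻¹).1 1 0 = 0
  simp [Matrix.mul_apply, Matrix.adjugate_fin_two, h1, h2]
  ring

theorem axiomA3_Gam : AxiomA3 Gam := by
  intro z B
  have hz := z.y_pos
  have hco : Continuous fun w : H3 => (w.x, w.y) := continuous_induced_dom
  have hcx : Continuous fun w : H3 => w.x := continuous_fst.comp hco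
  have hcy : Continuous fun w : H3 => w.y := continuous_snd.comp hco
  set U : Set H3 := {w | z.y / 2 < w.y ∧ w.y < 2 * z.y ∧
    Complex.normSq w.x < Complex.normSq z.x + 1} with hU
  have hUo : IsOpen U := (isOpen_lt continuous_const hcy).inter
    ((isOpen_lt hcy continuous_const).inter
      (isOpen_lt (Complex.continuous_normSq.comp hcx) continuous_const))
  refine ⟨U, hUo.mem_nhds ⟨by linarith, by linarith, by linarith⟩, ?_⟩
  have hfin := finite_bottomRow_denomSq_le (2 * z.y * Real.exp B) (Complex.normSq z.x + 1)
    (half_pos hz)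
  refine (hfin.image fun p => {h : Gam | ∃ g : Gam, bottomRow g = p ∧ h * g⁻¹ ∈ stab Gam 1}).subset
    ?_
  rintro _ ⟨⟨γ, rfl⟩, g, ⟨δ, hδ, rfl⟩, w, ⟨hw1, hw2, hw3⟩, hB⟩
  refine ⟨bottomRow (δ * γ), ⟨⟨_, rfl⟩, w, hw1.le, hw3.le, ?_⟩, ?_⟩
  · have h1 := coe_smul_y (δ * γ) w
    have h2 := coe_denomSq_pos (δ * γ) w
    change -Real.log ((δ * γ) • w).y ≤ B at hB
    rw [neg_le, Real.le_log_iff_exp_le ((δ * γ) • w).y_pos, h1, le_div_iff₀ h2, Real.exp_neg] at hB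
    have h3 := Real.exp_pos B
    have h4 := mul_le_mul_of_nonneg_left hB h3.le
    rw [mul_inv_cancel_left₀ h3.ne'] at h4
    refine h4.trans ?_
    nlinarith
  · ext h
    constructor
    · rintro ⟨g', hg', hh⟩
      refine ⟨h * γ⁻¹, ?_, by group⟩
      have h1 := mul_inv_mem_stab_one_of_bottomRow_eq hg'
      have h2 : h * γ⁻¹ = h * g'⁻¹ * (g' * (δ * γ)⁻¹) * δ := by group
      rw [h2]
      exact mul_mem (mul_mem hh h1) hδ
    · rintro ⟨ε, hε, rfl⟩
      refine ⟨δ * γ, rfl, ?_⟩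
      have : ε * γ * (δ * γ)⁻¹ = ε * δ⁻¹ := by group
      rw [this]
      exact mul_mem hε (inv_mem hδ)

/-! ### Generators of `Γ` -/

theorem exists_rotation : ∃ γ : Gam, ∀ z : H3,
    (γ • z).x = Complex.I * z.x ∧ (γ • z).y = z.y := by
  obtain ⟨a, ha⟩ := IsAlgClosed.exists_pow_nat_eq Complex.I two_pos
  have ha0 : a ≠ 0 := by
    rintro rfl
    rw [zero_pow two_ne_zero] at ha
    exact Complex.I_ne_zero ha.symm
  have had : a * a⁻¹ = 1 := mul_inv_cancel₀ ha0
  have hd : a⁻¹ ^ 2 = -Complex.I := by rw [inv_pow, ha, Complex.inv_I]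
  have hI := I_mem_gaussianSubring
  have hn : Complex.normSq a⁻¹ = 1 := by
    have h := congrArg Complex.normSq hd
    rw [map_pow, Complex.normSq_neg, Complex.normSq_I] at h
    have := Complex.normSq_nonneg a⁻¹
    nlinarith
  have hstar : star a⁻¹ = a := by
    have h1 : a⁻¹ * star a⁻¹ = 1 := by
      rw [RCLike.star_def, Complex.mul_conj, hn, Complex.ofReal_one]
    linear_combination a * h1 - star a⁻¹ * had
  refine ⟨⟨⟨!![a, 0; 0, a⁻¹], by rw [Matrix.det_fin_two_of]; simpa using had⟩,
    (mem_Gam_iff_entries rfl).2 ⟨⟨?_, ?_, ?_, ?_⟩, ?_, ?_, ?_, ?_, ?_⟩⟩, fun z => ?_⟩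
  · rw [ha, hd]
    simp
  · rw [ha, hd]
    ring_nf
    exact hI
  · rw [ha, hd]
    ring_nf
    exact gaussianSubring.neg_mem hI
  · rw [ha, hd]
    simp
  · simp
  · simp
  · simp
  · simp
  · rw [had]
    simp
  · have hden : denomSq 0 a⁻¹ z = 1 := by rw [denomSq]; simp only [zero_mul, zero_add, map_zero,
      add_zero, hn]
    constructor
    · change ((a * z.x + 0) * star (0 * z.x + a⁻¹) + a * star 0 * (z.y : ℂ) ^ 2)
        / (denomSq 0 a⁻¹ z : ℂ) = _
      rw [hden, zero_mul, zero_add, hstar, ← ha, star_zero, Complex.ofReal_one]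
      ring
    · change z.y / denomSq 0 a⁻¹ z = _
      rw [hden, div_one]

theorem exists_translation (k : GaussianInt) : ∃ γ : Gam, ∀ z : H3,
    (γ • z).x = z.x + (1 + Complex.I) * k ∧ (γ • z).y = z.y := by
  have hI := I_mem_gaussianSubring
  have h1 := gaussianSubring.one_mem
  have hk : (k : ℂ) ∈ gaussianSubring := ⟨k, rfl⟩
  have hm : (1 + Complex.I) * (k : ℂ) ∈ gaussianSubring :=
    gaussianSubring.mul_mem (gaussianSubring.add_mem h1 hI) hk
  have hm2 : Complex.I * (k : ℂ) ^ 2 ∈ gaussianSubring :=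
    gaussianSubring.mul_mem hI (pow_mem hk 2)
  have hsq : ((1 + Complex.I) * (k : ℂ)) ^ 2 = 2 * (Complex.I * (k : ℂ) ^ 2) := by
    linear_combination (k : ℂ) ^ 2 * Complex.I_sq
  refine ⟨⟨⟨!![1, (1 + Complex.I) * k; 0, 1], by rw [Matrix.det_fin_two_of]; ring⟩,
    (mem_Gam_iff_entries rfl).2 ⟨⟨?_, ?_, ?_, ?_⟩, ?_, ?_, ?_, ?_, ?_⟩⟩, fun z => ?_⟩
  · rw [hsq]
    convert gaussianSubring.sub_mem h1 hm2 using 1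
    ring
  · rw [hsq]
    convert hm2 using 1
    ring
  · rw [hsq]
    convert hm2 using 1
    ring
  · rw [hsq]
    convert gaussianSubring.add_mem h1 hm2 using 1
    ring
  · convert gaussianSubring.neg_mem hm using 1
    ring
  · convert hm using 1
    ring
  · convert hm using 1
    ring
  · convert hm using 1
    ring
  · convert h1 using 1
    ring
  · have hden : denomSq 0 1 z = 1 := by simp [denomSq]
    constructor
    · change ((1 * z.x + (1 + Complex.I) * k) * star (0 * z.x + 1) + 1 * star 0 * (z.y : ℂ) ^ 2)
        / (denomSq 0 1 z : ℂ) = _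
      rw [hden]
      simp
    · change z.y / denomSq 0 1 z = _
      rw [hden, div_one]

/-- The element of `Γ` whose isometric hemisphere is the floor of the polytope. -/
theorem exists_bottomRow_floor : ∃ γ : Gam, ∀ z : H3,
    denomSq (γ.1.1 1 0) (γ.1.1 1 1) z = (Complex.normSq (z.x - 1) + z.y ^ 2) / 2 := by
  have h2 : ((√2 : ℝ) : ℂ) ^ 2 = 2 := by
    rw [← Complex.ofReal_pow, Real.sq_sqrt zero_le_two]
    norm_num
  set q : ℂ := (((√2)⁻¹ : ℝ) : ℂ) with hq
  have hq2 : q ^ 2 = 1 / 2 := by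
    rw [hq, Complex.ofReal_inv, inv_pow, h2, one_div]
  have h0 := gaussianSubring.zero_mem
  have h1 := gaussianSubring.one_mem
  refine ⟨⟨⟨!![-q, -q; q, -q], by rw [Matrix.det_fin_two_of]; linear_combination 2 * hq2⟩,
    (mem_Gam_iff_entries rfl).2 ⟨⟨?_, ?_, ?_, ?_⟩, ?_, ?_, ?_, ?_, ?_⟩⟩, fun z => ?_⟩
  · convert h0 using 1
    ring
  · convert h0 using 1
    ring
  · convert h0 using 1
    ring
  · convert h1 using 1
    linear_combination 2 * hq2
  · convert gaussianSubring.neg_mem h1 using 1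
    linear_combination (-2) * hq2
  · convert h0 using 1
    ring
  · convert h1 using 1
    linear_combination 2 * hq2
  · convert h0 using 1
    ring
  · convert h0 using 1
    ring
  · change denomSq q (-q) z = _
    have hn : Complex.normSq q = 1 / 2 := by
      rw [hq, Complex.normSq_ofReal, ← mul_inv, Real.mul_self_sqrt zero_le_two, one_div]
    rw [denomSq, show q * z.x + -q = q * (z.x - 1) by ring, map_mul, hn]
    ring

/-! ### Fundamental domains -/

theorem isFundDomain_of_forall_mem_frontier {G X : Type*} [Group G] [TopologicalSpace X]
    {N H : Subgroup G} {act : G → X → X} {F : Set X} (hN : N.Normal)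
    (hone : ∀ x, act 1 x = x)
    (hmul : ∀ γ ∈ H, ∀ δ ∈ H, ∀ x, act (γ * δ) x = act γ (act δ x))
    (hcover : ∀ x, ∃ γ ∈ H, ∃ y ∈ F, act γ y = x)
    (hinter : ∀ γ ∈ H, γ ∉ N → ∀ x ∈ F, act γ x ∈ F → x ∈ frontier F) :
    IsFundDomain N H act F where
  cover x := by
    obtain ⟨γ, hγ, y, hy, h⟩ := hcover x
    exact ⟨γ, hγ, y, hy, h⟩
  inter := by
    have key : ∀ γ₁ ∈ H, ∀ γ₂ ∈ H, γ₁ * γ₂⁻¹ ∉ N → ∀ x ∈ F, ∀ y ∈ F,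
        act γ₁ x = act γ₂ y → x ∈ frontier F := by
      intro γ₁ h₁ γ₂ h₂ hn x hx y hy hxy
      have hy' : act (γ₂⁻¹ * γ₁) x = y := by
        rw [hmul _ (inv_mem h₂) _ h₁, hxy, ← hmul _ (inv_mem h₂) _ h₂, inv_mul_cancel, hone]
      refine hinter (γ₂⁻¹ * γ₁) (mul_mem (inv_mem h₂) h₁) (fun h => hn ?_) x hx (hy' ▸ hy)
      exact hN.mem_comm h
    rintro γ₁ h₁ γ₂ h₂ hn p ⟨⟨x, hx, rfl⟩, y, hy, hyx⟩
    refine ⟨⟨x, key γ₁ h₁ γ₂ h₂ hn x hx y hy hyx.symm, rfl⟩, y, ?_, hyx⟩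
    refine key γ₂ h₂ γ₁ h₁ (fun h => hn ?_) y hy x hx hyx
    simpa using inv_mem h

theorem normal_stab_three : (stab Gam 3).Normal where
  conj_mem γ hγ g := by
    rw [mem_stab_three_iff] at hγ ⊢
    intro z
    rw [mul_smul, mul_smul, hγ, smul_inv_smul]

theorem isClosed_triangle : IsClosed triangle :=
  (Set.toFinite _).isClosed_convexHull (𝕜 := ℝ)

theorem lt_of_mem_interior_triangle {w : ℂ} (hw : w ∈ interior triangle) :
    1 < w.re ∧ 0 < w.im ∧ w.re + w.im < 2 := by
  have key : ∀ v : ℂ, ∃ ε : ℝ, 0 < ε ∧ w + ε * v ∈ triangle := by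
    intro v
    have h1 : ContinuousAt (fun ε : ℝ => w + ε * v) 0 := by fun_prop
    have h2 := h1.preimage_mem_nhds (t := triangle)
      (by simpa using mem_interior_iff_mem_nhds.1 hw)
    obtain ⟨ε, hε, h3⟩ := ((eventually_nhdsWithin_of_eventually_nhds h2).and
      (self_mem_nhdsWithin (a := (0 : ℝ)) (s := Ioi 0))).exists
    exact ⟨ε, h3, hε⟩
  obtain ⟨ε₁, h1, h1'⟩ := key (-1)
  obtain ⟨ε₂, h2, h2'⟩ := key (-Complex.I)
  obtain ⟨ε₃, h3, h3'⟩ := key 1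
  rw [mem_triangle_iff] at h1' h2' h3'
  simp only [Complex.add_re, Complex.add_im, Complex.re_ofReal_mul, Complex.im_ofReal_mul,
    Complex.neg_re, Complex.neg_im, Complex.one_re, Complex.one_im, Complex.I_re,
    Complex.I_im] at h1' h2' h3'
  exact ⟨by linarith, by linarith, by linarith⟩

theorem triangle_eq_closure_interior : triangle = closure (interior triangle) := by
  have hne : (interior triangle).Nonempty := by
    have hO : IsOpen {w : ℂ | 1 < w.re ∧ 0 < w.im ∧ w.re + w.im < 2} :=
      (isOpen_lt continuous_const Complex.continuous_re).inter
        ((isOpen_lt continuous_const Complex.continuous_im).inter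
          (isOpen_lt (Complex.continuous_re.add Complex.continuous_im) continuous_const))
    refine ⟨⟨5 / 4, 1 / 4⟩, mem_interior.2 ⟨_, fun w hw => ?_, hO, ?_⟩⟩
    · exact mem_triangle_iff.2 ⟨hw.1.le, hw.2.1.le, hw.2.2.le⟩
    · norm_num
  have h : Convex ℝ triangle := convex_convexHull ℝ _
  rw [h.closure_interior_eq_closure_of_nonempty_interior hne, isClosed_triangle.closure_eq]

theorem inducedAct_of_smul {γ : Gam} {u m : ℂ} (h : ∀ z : H3, (γ • z).x = u * z.x + m) (w : ℂ) :
    inducedAct γ w = u * w + m := by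
  rw [inducedAct, phi23_eq, h, sigma23_x]

/-- The open triangle contains no two points equivalent under a nontrivial map `x ↦ u x + m` with
`u` a power of `i` and `m` divisible by `1 + i`. In the coordinates `s, t` of `x = 1 + s + t i` the
translation part becomes `m + u - 1`, with the same parity as `m`. -/
theorem eq_of_mem_interior_triangle {u m : GaussianInt}
    (hu : u = 1 ∨ u = -1 ∨ u = ⟨0, 1⟩ ∨ u = ⟨0, -1⟩) (hm : parity m = 0) {x : ℂ}
    (hx : x ∈ interior triangle) (hx' : (u : ℂ) * x + m ∈ triangle) : u = 1 ∧ m = 0 := by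
  obtain ⟨h1, h2, h3⟩ := lt_of_mem_interior_triangle hx
  obtain ⟨h4, h5, h6⟩ := mem_triangle_iff.1 hx'
  rw [parity_eq_zero_iff] at hm
  obtain ⟨p, q⟩ := m
  simp only [Complex.add_re, Complex.add_im, Complex.mul_re, Complex.mul_im] at h4 h5 h6 hm
  rcases hu with rfl | rfl | rfl | rfl
  · simp [GaussianInt.toComplex_def] at h4 h5 h6
    have hl0 : (-1 : ℝ) < p := by linarith
    have hu0 : (p : ℝ) < 1 := by linarith
    norm_cast at hl0 hu0
    have hl1 : (-1 : ℝ) < q := by linarith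
    have hu1 : (q : ℝ) < 1 := by linarith
    norm_cast at hl1 hu1
    exact ⟨rfl, Zsqrtd.ext (by simp; omega) (by simp; omega)⟩
  · simp [GaussianInt.toComplex_def] at h4 h5 h6
    have hl0 : (2 : ℝ) < p := by linarith
    have hu0 : (p : ℝ) < 4 := by linarith
    norm_cast at hl0 hu0
    have hl1 : (0 : ℝ) < q := by linarith
    have hu1 : (q : ℝ) < 2 := by linarith
    norm_cast at hl1 hu1
    obtain rfl : p = 3 := by omega
    obtain rfl : q = 1 := by omega
    norm_num at h6
    linarith
  · simp [GaussianInt.toComplex_def] at h4 h5 h6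
    have hl0 : (1 : ℝ) < p := by linarith
    have hu0 : (p : ℝ) < 3 := by linarith
    norm_cast at hl0 hu0
    have hl1 : (-2 : ℝ) < q := by linarith
    have hu1 : (q : ℝ) < 0 := by linarith
    norm_cast at hl1 hu1
    omega
  · simp [GaussianInt.toComplex_def] at h4 h5 h6
    have hl0 : (0 : ℝ) < p := by linarith
    have hu0 : (p : ℝ) < 2 := by linarith
    norm_cast at hl0 hu0
    have hl1 : (1 : ℝ) < q := by linarith
    have hu1 : (q : ℝ) < 3 := by linarith
    norm_cast at hl1 hu1
    omega

/-- The rotation `x ↦ i x` and the translations by multiples of `1 + i` suffice to bring any point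
of `ℂ` into the triangle. -/
theorem exists_inducedAct_eq (w : ℂ) :
    ∃ γ ∈ stab Gam 1, ∃ v ∈ triangle, inducedAct γ v = w := by
  obtain ⟨ρ, hρ⟩ := exists_rotation
  have hstab : ∀ {γ : Gam}, (∀ z : H3, (γ • z).y = z.y) → γ ∈ stab Gam 1 := by
    intro γ h z i hi
    obtain rfl : i = 0 := Fin.ext (by simpa using hi)
    exact phi_zero_eq_iff.2 (h z)
  -- powers of `i` as multipliers
  have hrot : ∀ j : ℕ, ∀ z : H3, ((ρ ^ j) • z).x = Complex.I ^ j * z.x ∧ ((ρ ^ j) • z).y = z.y := by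
    intro j
    induction j with
    | zero => intro z; simp
    | succ j ih =>
      intro z
      rw [pow_succ', mul_smul, (hρ _).1, (hρ _).2, (ih z).1, (ih z).2, pow_succ', mul_assoc]
      exact ⟨rfl, rfl⟩
  have hact : ∀ (j : ℕ) (k : GaussianInt), ∃ γ ∈ stab Gam 1, ∀ v,
      inducedAct γ v = Complex.I ^ j * v + (1 + Complex.I) * k := by
    intro j k
    obtain ⟨τ, hτ⟩ := exists_translation k
    refine ⟨τ * ρ ^ j, hstab fun z => ?_, fun v => inducedAct_of_smul (fun z => ?_) v⟩
    · rw [mul_smul, (hτ _).2, (hrot j z).2]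
    · rw [mul_smul, (hτ _).1, (hrot j z).1]
  -- translate `w` into the square with vertices `0, 2, 1 + i, 1 - i`
  set P := w.re - 1 + w.im with hP
  set Q := w.re - 1 - w.im with hQ
  set k := round (P / 2) with hk
  set l := round (Q / 2) with hl
  have h1 := abs_le.1 (abs_sub_round (P / 2))
  have h2 := abs_le.1 (abs_sub_round (Q / 2))
  rw [← hk] at h1
  rw [← hl] at h2
  set s := w.re - 1 - (k + l) with hs
  set t := w.im - (k - l) with ht
  -- `k + l + (k - l) i = (1 + i) (k - l i)`
  have hw : w = 1 + (s + t * Complex.I) + (1 + Complex.I) * ((⟨k, -l⟩ : GaussianInt) : ℂ) := by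
    apply Complex.ext
    · simp [GaussianInt.toComplex_def, hs]
      ring
    · simp [GaussianInt.toComplex_def, ht]
      ring
  have hst : s + t ≤ 1 ∧ -1 ≤ s + t ∧ s - t ≤ 1 ∧ -1 ≤ s - t :=
    ⟨by linarith, by linarith, by linarith, by linarith⟩
  obtain ⟨h3, h4, h5, h6⟩ := hst
  -- rotate about `1`: `1 + iʲ (v - 1) = iʲ v + (1 + i) n`
  have key : ∀ (j : ℕ) (n : GaussianInt) (a b : ℝ), 0 ≤ a → 0 ≤ b → a + b ≤ 1 →
      (1 - Complex.I ^ j = (1 + Complex.I) * n) →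
      (s + t * Complex.I = Complex.I ^ j * (a + b * Complex.I)) →
      ∃ γ ∈ stab Gam 1, ∃ v ∈ triangle, inducedAct γ v = w := by
    intro j n a b ha hb hab hn hj
    obtain ⟨γ, hγ, h⟩ := hact j (n + ⟨k, -l⟩)
    refine ⟨γ, hγ, 1 + (a + b * Complex.I), ?_, ?_⟩
    · rw [mem_triangle_iff]
      simp
      exact ⟨ha, hb, by linarith⟩
    · rw [h, hw, hj, GaussianInt.toComplex_add]
      linear_combination -hn
  have hI := Complex.I_sq
  rcases le_total 0 s with hs0 | hs0 <;> rcases le_total 0 t with ht0 | ht0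
  · exact key 0 0 s t hs0 ht0 h3 (by simp) (by simp)
  · refine key 3 1 (-t) s (by linarith) hs0 (by linarith) ?_ ?_
    · rw [GaussianInt.toComplex_one]
      linear_combination (-Complex.I) * hI
    · push_cast
      linear_combination (s - s * Complex.I ^ 2 + t * Complex.I) * hI
  · refine key 1 ⟨0, -1⟩ t (-s) ht0 (by linarith) (by linarith) ?_ ?_
    · simp [GaussianInt.toComplex_def]
      linear_combination hI
    · push_cast
      linear_combination s * hI
  · refine key 2 ⟨1, -1⟩ (-s) (-t) (by linarith) (by linarith) (by linarith) ?_ ?_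
    · simp [GaussianInt.toComplex_def]
      linear_combination hI
    · push_cast
      linear_combination (s + t * Complex.I) * hI

theorem inducedAct_mul {γ δ : Gam} (hγ : γ ∈ stab Gam 1) (w : ℂ) :
    inducedAct (γ * δ) w = inducedAct γ (inducedAct δ w) := by
  obtain ⟨u, m, -, -, h⟩ := smul_of_lower_left_eq_zero (mem_stab_one_iff.1 hγ)
  rw [inducedAct_of_smul fun z => (h z).1, inducedAct, mul_smul, phi23_eq, (h _).1]
  rfl

/-- An element of `Γ` that fixes `∞` and maps an interior point of the triangle into the triangle
acts trivially. -/
theorem mem_stab_three_of_mem_interior {γ : Gam} (hγ : γ ∈ stab Gam 1) {w : ℂ}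
    (hw : w ∈ interior triangle) (hw' : inducedAct γ w ∈ triangle) : γ ∈ stab Gam 3 := by
  obtain ⟨u, m, hu, hm, h⟩ := smul_of_lower_left_eq_zero (mem_stab_one_iff.1 hγ)
  rw [inducedAct_of_smul fun z => (h z).1] at hw'
  obtain ⟨rfl, rfl⟩ := eq_of_mem_interior_triangle hu hm hw hw'
  refine mem_stab_three_iff.2 fun z => H3.ext ?_ (h z).2
  rw [(h z).1, GaussianInt.toComplex_one, GaussianInt.toComplex_zero, one_mul, add_zero]

theorem mem_frontier_iff_notMem_interior {X : Type*} [TopologicalSpace X] {F : Set X} {x : X}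
    (hx : x ∈ F) : x ∈ frontier F ↔ x ∉ interior F :=
  ⟨fun h => h.2, fun h => ⟨subset_closure hx, h⟩⟩

theorem isFundDomain_triangle :
    IsFundDomain (stab Gam 3) (stab Gam 1) inducedAct triangle := by
  refine isFundDomain_of_forall_mem_frontier normal_stab_three (fun w => ?_)
    (fun γ hγ δ _ w => inducedAct_mul hγ w) exists_inducedAct_eq (fun γ hγ hn w hw hw' => ?_)
  · rw [inducedAct, one_smul, phi23_eq, sigma23_x]
  · rw [mem_frontier_iff_notMem_interior hw]
    exact fun h => hn (mem_stab_three_of_mem_interior hγ h hw')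

/-- Among the points of `1 + (1 + i) ℤ[i]`, `1` is a closest one to any point of the triangle. -/
theorem normSq_sub_one_le {x : ℂ} (hx : x ∈ triangle) {t : GaussianInt} (ht : parity t = 1) :
    Complex.normSq (x - 1) ≤ Complex.normSq (x + t) := by
  obtain ⟨h1, h2, h3⟩ := mem_triangle_iff.1 hx
  have hodd : ¬ 2 ∣ t.re + t.im := by
    rw [← parity_eq_zero_iff, ht]
    decide
  obtain ⟨p, q⟩ := t
  simp only at hodd
  have hpos : ∀ a b : ℤ, (a ≠ 0 ∨ b ≠ 0) → (1 : ℝ) ≤ (a : ℝ) ^ 2 + (b : ℝ) ^ 2 := by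
    intro a b hab
    have : 0 < a ^ 2 + b ^ 2 := by
      rcases hab with h | h <;> positivity
    exact_mod_cast this
  have e1 := hpos (p + 2) q (by omega)
  have e2 := hpos (p + 1) (q + 1) (by omega)
  have e3 : (0 : ℝ) ≤ ((p : ℝ) + 1) ^ 2 + (q : ℝ) ^ 2 := by positivity
  push_cast at e1 e2
  simp only [Complex.normSq_apply, Complex.sub_re, Complex.sub_im, Complex.one_re, Complex.one_im,
    Complex.add_re, Complex.add_im, GaussianInt.re_toComplex, GaussianInt.im_toComplex]
  -- in the coordinates `x = 1 + s + t i`, a combination of the three bounds with the weights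
  -- `s`, `t` and `1 - s - t`
  nlinarith [mul_le_mul_of_nonneg_left e1 (sub_nonneg.2 h1), mul_le_mul_of_nonneg_left e2 h2,
    mul_le_mul_of_nonneg_left e3 (sub_nonneg.2 h3)]

theorem floorDomain_eq_inter_F1 : floorDomain = phi23 ⁻¹' triangle ∩ F1 Gam := by
  ext z
  rw [mem_inter_iff, mem_preimage, phi23_eq, mem_F1_iff]
  refine and_congr_right fun hT => ⟨fun hfl γ => ?_, fun h => ?_⟩
  · by_cases hc : γ.1.1 1 0 = 0
    · exact (phi_smul_eq_phi_iff.1 (mem_stab_one_iff.2 hc z 0 zero_lt_one)).ge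
    have hle : Complex.normSq (z.x - 1) ≤ 1 := by
      obtain ⟨h1, h2, h3⟩ := mem_triangle_iff.1 hT
      simp only [Complex.normSq_apply, Complex.sub_re, Complex.sub_im, Complex.one_re,
        Complex.one_im]
      nlinarith
    rcases row_of_mem_Gam γ.2 hc with h | ⟨h, t, ht, hd⟩
    · have := Complex.normSq_nonneg (γ.1.1 1 0 * z.x + γ.1.1 1 1)
      rw [denomSq]
      nlinarith
    · have := normSq_sub_one_le hT ht
      rw [denomSq, hd, ← mul_add, map_mul, h]
      linarith
  · obtain ⟨γ, hγ⟩ := exists_bottomRow_floor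
    have := h γ
    rw [hγ] at this
    linarith

/-- Every orbit of `Γ` contains a point of maximal height. -/
theorem exists_smul_mem_F1 (z : H3) : ∃ γ : Gam, γ • z ∈ F1 Gam := by
  have hfin : {p : ℂ × ℂ | (∃ γ : Gam, bottomRow γ = p) ∧ denomSq p.1 p.2 z ≤ 1}.Finite :=
    (finite_bottomRow_denomSq_le 1 (Complex.normSq z.x) z.y_pos).subset
      fun p hp => ⟨hp.1, z, le_rfl, le_rfl, hp.2⟩
  have hne : {p : ℂ × ℂ | (∃ γ : Gam, bottomRow γ = p) ∧ denomSq p.1 p.2 z ≤ 1}.Nonempty :=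
    ⟨_, ⟨1, rfl⟩, by simp [bottomRow, denomSq]⟩
  obtain ⟨_, ⟨⟨γ, rfl⟩, hγ⟩, hmin⟩ := hfin.exists_minimalFor (fun p => denomSq p.1 p.2 z) _ hne
  refine ⟨γ, fun δ => ?_⟩
  rw [← mul_smul, phi_zero_le_iff, coe_smul_y, coe_smul_y]
  refine div_le_div_of_nonneg_left z.y_pos.le (coe_denomSq_pos γ z) ?_
  rcases le_total (denomSq ((δ * γ).1.1 1 0) ((δ * γ).1.1 1 1) z)
    (denomSq (γ.1.1 1 0) (γ.1.1 1 1) z) with h | h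
  · exact hmin (j := bottomRow (δ * γ)) ⟨⟨_, rfl⟩, h.trans hγ⟩ h
  · exact h

theorem isFundDomain_floorDomain :
    IsFundDomain (stab Gam 3) ⊤ (fun (γ : Gam) (z : H3) => γ • z) floorDomain := by
  refine isFundDomain_of_forall_mem_frontier normal_stab_three (fun z => one_smul Gam z)
    (fun γ _ δ _ z => mul_smul γ δ z) (fun z => ?_) (fun γ _ hn z hz hz' => ?_)
  · obtain ⟨γ, hγ⟩ := exists_smul_mem_F1 z
    obtain ⟨δ, hδ, v, hv, hvw⟩ := exists_inducedAct_eq (γ • z).x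
    refine ⟨γ⁻¹ * δ, trivial, δ⁻¹ • γ • z, ?_, by simp [mul_smul]⟩
    have hδ' := inv_mem hδ
    rw [floorDomain_eq_inter_F1]
    constructor
    · obtain ⟨u, m, -, -, h⟩ := smul_of_lower_left_eq_zero (mem_stab_one_iff.1 hδ')
      have h1 : inducedAct δ⁻¹ (γ • z).x = v := by
        rw [← hvw, ← inducedAct_mul hδ', inv_mul_cancel, inducedAct, one_smul, phi23_eq, sigma23_x]
      rw [mem_preimage, phi23_eq, (h _).1, ← inducedAct_of_smul (fun z => (h z).1), h1]
      exact hv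
    · intro ε
      rw [hδ' _ 0 zero_lt_one, ← mul_smul]
      exact hγ _
  · rw [mem_frontier_iff_notMem_interior hz]
    intro hint
    rw [floorDomain_eq_inter_F1] at hz hz'
    have hden : denomSq (γ.1.1 1 0) (γ.1.1 1 1) z = 1 := by
      refine phi_smul_eq_phi_iff.1 (le_antisymm ?_ (hz.2 γ))
      simpa using hz'.2 γ⁻¹
    by_cases hc : γ.1.1 1 0 = 0
    · -- the horizontal slice through `z` of the interior lies over the interior of the triangle
      have hs := mem_stab_one_iff.2 hc
      have hcont : Continuous fun w : ℂ => (⟨w, z.y, z.y_pos⟩ : H3) :=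
        continuous_induced_rng.2 (continuous_id.prodMk continuous_const)
      have hzi : z.x ∈ interior triangle := by
        refine mem_interior.2 ⟨_, fun w hw => ?_, isOpen_interior.preimage hcont, hint⟩
        exact (interior_subset hw).1
      obtain ⟨u, m, -, -, h⟩ := smul_of_lower_left_eq_zero hc
      refine hn (mem_stab_three_of_mem_interior hs hzi ?_)
      rw [inducedAct_of_smul fun z => (h z).1, ← (h z).1]
      exact hz'.1
    · -- lowering `z` makes `|c x + d|² + |c|² y²` smaller than `1`
      have hcont : Continuous fun s : ℝ =>
          (⟨z.x, z.y * Real.exp s, mul_pos z.y_pos (Real.exp_pos s)⟩ : H3) :=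
        continuous_induced_rng.2 (by
          change Continuous fun s : ℝ => (z.x, z.y * Real.exp s)
          fun_prop)
      have h0 : (⟨z.x, z.y * Real.exp 0, mul_pos z.y_pos (Real.exp_pos 0)⟩ : H3) = z :=
        H3.ext rfl (by simp)
      have h1 : ∀ᶠ s in 𝓝 (0 : ℝ),
          (⟨z.x, z.y * Real.exp s, mul_pos z.y_pos (Real.exp_pos s)⟩ : H3) ∈ interior floorDomain :=
        hcont.continuousAt.preimage_mem_nhds (isOpen_interior.mem_nhds (by rwa [h0]))
      obtain ⟨s, h2, h3⟩ := ((eventually_nhdsWithin_of_eventually_nhds h1).and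
        (self_mem_nhdsWithin (a := (0 : ℝ)) (s := Iio 0))).exists
      have h4 := interior_subset h2
      rw [floorDomain_eq_inter_F1] at h4
      have h5 := mem_F1_iff.1 h4.2 γ
      rw [← hden, denomSq, denomSq, add_le_add_iff_left,
        mul_le_mul_iff_right₀ (Complex.normSq_pos.2 hc)] at h5
      have h6 : z.y * Real.exp s < z.y :=
        mul_lt_of_lt_one_right z.y_pos (Real.exp_lt_one_iff.2 h3)
      have h7 := mul_pos z.y_pos (Real.exp_pos s)
      have h8 : (z.y * Real.exp s) ^ 2 < z.y ^ 2 := by gcongr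
      exact absurd h5 (not_le.2 h8)

theorem isGoodGrenierDomain_floorDomain : IsGoodGrenierDomain Gam triangle floorDomain where
  a1 := axiomA1_Gam
  a2 := axiomA2_Gam
  a3 := axiomA3_Gam
  a4 := axiomA4_Gam
  base := isFundDomain_triangle
  base_regular := triangle_eq_closure_interior
  eq := floorDomain_eq_inter_F1
  fund := isFundDomain_floorDomain

end Grenier

theorem mainTheorem1 :
    Grenier.IsSolidPolytope Grenier.vertices (Grenier.hypHull (Set.range Grenier.vertices)) ∧
    Grenier.IsGoodGrenierDomain Grenier.Gam Grenier.triangle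
      (Grenier.toBar ⁻¹' Grenier.hypHull (Set.range Grenier.vertices)) ∧
    Grenier.hypHull (Set.range Grenier.vertices) =
      insert OnePoint.infty (Grenier.toBar ''
        (Grenier.toBar ⁻¹' Grenier.hypHull (Set.range Grenier.vertices))) := by
  refine ⟨Grenier.isSolidPolytope_vertices, ?_, ?_⟩
  · rw [Grenier.preimage_hypHull_vertices]
    exact Grenier.isGoodGrenierDomain_floorDomain
  · rw [Grenier.preimage_hypHull_vertices]
    exact Grenier.hypHull_vertices
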